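/- For $n\ge 0$ let $M_n=F_n/F_n''$ be the free metabelian group of rank $n$, where $F_n$ is the free group on $x_1,\dots,x_n$ and $F_n''$ is its second derived subgroup. A \emph{bi-order} on a group $G$ is a total order $\leqslant$ such that $g\leqslant h$ implies $f_1gf_2\leqslant f_1hf_2$ for all $f_1,f_2\in G$; its positive cone is $\{g\in G: g>1\}$. Let $X$ be a finite generating set of $G$. A bi-order on $G$ is \emph{computable} if there is an algorithm that decides, for any two words $u,v$ over $X\cup X^{-1}$, whether $u\leqslant v$ in $G$; it is \emph{regular} (respectively \emph{context-free}) if some regular (respectively context-free) language of words over $X\cup X^{-1}$ evaluates onto its positive cone. On $M_n$ these properties are asserted for every finite generating set $X$, with the same bi-order. 1. For every $n\ge 0$, the group $M_n$ is computably bi-orderable, that is, it admits a computable bi-order. More precisely, let $A_n$ and $T_n$ be free abelian groups with bases $a_1,\dots,a_n$ and $t_1,\dots,t_n$, and let $A_n\wr T_n=B\rtimes T_n$, with $B=\bigoplus_{t\in T_n}A_n$, be their restricted wreath product. The Magnus homomorphism $\varphi:M_n\to A_n\wr T_n$, $\varphi(x_i)=a_it_i$, is well defined and injective. There are bi-orders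 on $A_n$ and on $T_n$, regular with respect to the given bases, such that the following lexicographic order led by the quotient $T_n$ is a bi-order on $A_n\wr T_n$: an element is positive if its image in $T_n$ is positive, or if it lies in $B$, equals $g_1^{h_1}\cdots g_s^{h_s}$ with $s\ge 1$, $1\neq g_i\in A_n$, $h_i\in T_n$, $h_1>h_2>\dots>h_s$ (where $g^h=h^{-1}gh$), and $g_1>1$ in $A_n$. Its pullback to $M_n$ along $\varphi$ is a computable bi-order on $M_n$. 2. $M_1\cong\mathbb Z$, and $M_1$ admits a regular bi-order. 3. $M_2$ admits a context-free bi-order. -/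

import Mathlib

namespace BiOrd

section Orders

variable {G : Type*} [Group G]

/-- A bi-order on a group: a total order which is invariant under multiplication from both sides.
The relation `r g h` stands for `g ≤ h`. -/
structure IsBiOrder (r : G → G → Prop) : Prop where
  isLinearOrder : IsLinearOrder G r
  mul_le_mul : ∀ f₁ f₂ g h : G, r g h → r (f₁ * g * f₂) (f₁ * h * f₂)

/-- The strict relation `g < h` of an order. -/
def Lt (r : G → G → Prop) (g h : G) : Prop := r g h ∧ g ≠ h

/-- The positive cone `{g | 1 < g}` of an order. -/
def positiveCone (r : G → G → Prop) : Set G := {g | Lt r 1 g}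

/-- Words over `X ∪ X⁻¹`, for `X` a family indexed by `Fin k`: the letter `(i, true)` stands for
the `i`-th generator, the letter `(i, false)` for its inverse. -/
abbrev Word (k : ℕ) : Type := List (Fin k × Bool)

/-- The evaluation map from words to the group. -/
def eval {k : ℕ} (s : Fin k → G) (w : Word k) : G :=
  (w.map fun p => if p.2 then s p.1 else (s p.1)⁻¹).prod

/-- The finite family `s` generates `G`. -/
def Generates {k : ℕ} (s : Fin k → G) : Prop := Subgroup.closure (Set.range s) = ⊤

/-- There is an algorithm deciding whether `u ≤ v` in `G`, for any pair of words `u, v`. -/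
def IsComputableFor {k : ℕ} (s : Fin k → G) (r : G → G → Prop) : Prop :=
  ComputablePred fun p : Word k × Word k => r (eval s p.1) (eval s p.2)

/-- Some regular language of words evaluates onto the positive cone. -/
def IsRegularFor {k : ℕ} (s : Fin k → G) (r : G → G → Prop) : Prop :=
  ∃ L : Language (Fin k × Bool), L.IsRegular ∧ eval s '' {w | w ∈ L} = positiveCone r

/-- Some context-free language of words evaluates onto the positive cone. -/
def IsContextFreeFor {k : ℕ} (s : Fin k → G) (r : G → G → Prop) : Prop :=
  ∃ L : Language (Fin k × Bool), L.IsContextFree ∧ eval s '' {w | w ∈ L} = positiveCone r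

/-- A computable order on a finitely generated group, for every finite generating family. -/
def IsComputableOrder (r : G → G → Prop) : Prop :=
  Group.FG G ∧ ∀ (k : ℕ) (s : Fin k → G), Generates s → IsComputableFor s r

/-- A regular order on a finitely generated group, for every finite generating family. -/
def IsRegularOrder (r : G → G → Prop) : Prop :=
  Group.FG G ∧ ∀ (k : ℕ) (s : Fin k → G), Generates s → IsRegularFor s r

/-- A context-free order on a finitely generated group, for every finite generating family. -/
def IsContextFreeOrder (r : G → G → Prop) : Prop :=
  Group.FG G ∧ ∀ (k : ℕ) (s : Fin k → G), Generates s → IsContextFreeFor s r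

end Orders

/-- A group is computably bi-orderable if it admits a computable bi-order. -/
def ComputablyBiOrderable (G : Type*) [Group G] : Prop :=
  ∃ r : G → G → Prop, IsBiOrder r ∧ IsComputableOrder r

/-- The free metabelian group of rank `n`: the free group of rank `n` modulo its second derived
subgroup. -/
abbrev FreeMetabelian (n : ℕ) : Type :=
  FreeGroup (Fin n) ⧸ derivedSeries (FreeGroup (Fin n)) 2

/-- The canonical generators of the free metabelian group. -/
def FreeMetabelian.gen {n : ℕ} (i : Fin n) : FreeMetabelian n :=
  QuotientGroup.mk (FreeGroup.of i)

section WreathProduct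

variable (A T : Type*) [CommGroup A] [Group T]

/-- The base group `⨁_{t ∈ T} A`, written multiplicatively. -/
abbrev Base : Type _ := Multiplicative (T →₀ Additive A)

variable {A T}

/-- The coordinate at `t` of an element of the base group. -/
def coord (f : Base A T) (t : T) : A := (Multiplicative.toAdd f t).toMul

variable (A T)

/-- The action of `T` on the base group by translation of the coordinates:
`t • f = (q ↦ f (q * t))`. With it, the element of the base group with the single non-trivial
coordinate `a` at `h` is the conjugate `a ^ h = h⁻¹ * a * h` of the copy of `a` at the
coordinate `1`. -/
noncomputable def wreathAction : T →* MulAut (Base A T) where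
  toFun t := AddEquiv.toMultiplicative (Finsupp.domCongr (Equiv.mulRight t⁻¹))
  map_one' := by
    ext f : 1
    apply Multiplicative.toAdd.injective
    ext q
    change Multiplicative.toAdd f (q * (1⁻¹)⁻¹) = Multiplicative.toAdd f q
    simp
  map_mul' s t := by
    ext f : 1
    apply Multiplicative.toAdd.injective
    ext q
    change Multiplicative.toAdd f (q * ((s * t)⁻¹)⁻¹) =
      Multiplicative.toAdd f ((q * (s⁻¹)⁻¹) * (t⁻¹)⁻¹)
    simp [mul_assoc]

/-- The (restricted) wreath product `A ≀ T`, the semidirect product of `⨁_{t ∈ T} A` and `T`. -/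
abbrev Wreath : Type _ := Base A T ⋊[wreathAction A T] T

variable {A T}

/-- The embedding of `A` into `A ≀ T` at the coordinate `1` of the base group. -/
noncomputable def Wreath.ofA (a : A) : Wreath A T :=
  SemidirectProduct.inl (Multiplicative.ofAdd (Finsupp.single 1 (Additive.ofMul a)))

/-- The embedding of `T` into `A ≀ T`. -/
noncomputable def Wreath.ofT (t : T) : Wreath A T := SemidirectProduct.inr t

/-- `f > 1` in the base group: the coordinate of `f` at the greatest element of its support,
with respect to the order of `T`, exists and is positive in `A`. -/
def BasePositive (rA : A → A → Prop) (rT : T → T → Prop) (f : Base A T) : Prop :=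
  ∃ h : T, coord f h ∈ positiveCone rA ∧ ∀ h' : T, coord f h' ≠ 1 → rT h' h

/-- The positive elements of the lexicographic order on `A ≀ T` led by the quotient `T`. -/
def lexCone (rA : A → A → Prop) (rT : T → T → Prop) : Set (Wreath A T) :=
  {g | g.right ∈ positiveCone rT ∨ (g.right = 1 ∧ BasePositive rA rT g.left)}

/-- The lexicographic order on `A ≀ T` led by the quotient `T`. -/
def lexOrder (rA : A → A → Prop) (rT : T → T → Prop) (g h : Wreath A T) : Prop :=
  g = h ∨ g⁻¹ * h ∈ lexCone rA rT

end WreathProduct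

/-- The free abelian group `ℤⁿ`, written multiplicatively. -/
abbrev FreeAb (n : ℕ) : Type := Multiplicative (Fin n → ℤ)

/-- The standard basis of `ℤⁿ`. -/
def FreeAb.basis {n : ℕ} (i : Fin n) : FreeAb n := Multiplicative.ofAdd (Pi.single i 1)

/-- `φ` is the Magnus homomorphism `M_n → ℤⁿ ≀ ℤⁿ`: it sends the `i`-th canonical generator to
the product of the `i`-th basis elements of the two factors. -/
def IsMagnus {n : ℕ} (φ : FreeMetabelian n →* Wreath (FreeAb n) (FreeAb n)) : Prop :=
  ∀ i : Fin n, φ (FreeMetabelian.gen i) =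
    Wreath.ofA (FreeAb.basis i) * Wreath.ofT (FreeAb.basis i)

end BiOrd

namespace BiOrd

/-! ### Bi-orders and their positive cones -/

section Cones

variable {G H : Type*} [Group G] [Group H]

/-! The Magnus map records a word as a path in the Cayley graph of `ℤⁿ`: the quotient component is
the endpoint, and the base component counts, with sign, the crossings of each edge. Conjugating an
element of the abelian base translates its coordinates, and translations preserve the order of `T`.
Hence the lexicographic cone is invariant for arbitrary bi-orders on the two factors
(`lexOrder_isBiOrder`), and the order pulls back along any injective map.

Injectivity (`magnus_injective`): after choosing a section of `F_n → ℤⁿ`, every edge gives a loop in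
the derived subgroup `F_n'`. The edge counts of `w` determine the class of its loop in the
abelianization of `F_n'` (`edgeLoop_magnusFree`), so trivial edge counts and a trivial endpoint
force `w` into `F_n''`.

Computability: the edge counts of a word vanish away from the finitely many places it visits, so its
sign is found by a bounded, primitive recursive search (`primrecPred_traceNonneg`,
`magnusOrder_one_iff`). In rank one the positive cone consists of the positive powers of a
generator, spelled by repetitions of one word.

In rank two the loops are generated by the conjugates of the single commutator `genC`
(`mem_squares_of_exponents`). These conjugates commute, and each depends only on the image of the
conjugator in `ℤ²` (`conj_eq_conj`). The leading coefficient of each is positive, at a place of its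
own. So a nontrivial loop is a nonzero power of one conjugate times conjugates at lower places, and
its sign is that of the exponent. Conjugation is a nested pair of brackets, so a context-free
grammar produces such products. Its terminals are group elements, to be spelled over any generating
family (`exists_isContextFree_leastSolution`). For completeness (`coneSet_start`) it is enough that
every loop is trivial, generated, or the inverse of a generated one: soundness of the grammar
excludes the wrong sign. -/

theorem isBiOrder_of_cone {P : Set G} (one : (1 : G) ∉ P)
    (mul : ∀ g ∈ P, ∀ h ∈ P, g * h ∈ P) (conj : ∀ f, ∀ g ∈ P, f * g * f⁻¹ ∈ P)
    (total : ∀ g : G, g ≠ 1 → g ∈ P ∨ g⁻¹ ∈ P) :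
    IsBiOrder (fun g h : G => g = h ∨ g⁻¹ * h ∈ P) where
  isLinearOrder :=
    { refl := fun g => Or.inl rfl
      trans := by
        rintro a b c (rfl | hab) (rfl | hbc)
        · exact Or.inl rfl
        · exact Or.inr hbc
        · exact Or.inr hab
        · right
          have := mul _ hab _ hbc
          rwa [mul_assoc, mul_inv_cancel_left] at this
      antisymm := by
        rintro a b (rfl | hab) (h | hba)
        · rfl
        · rfl
        · exact h.symm
        · exact absurd (by simpa [mul_assoc] using mul _ hab _ hba) one
      total := by
        intro a b
        by_cases h : a⁻¹ * b = 1
        · exact Or.inl (Or.inl (inv_mul_eq_one.mp h))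
        · rcases total _ h with h | h
          · exact Or.inl (Or.inr h)
          · exact Or.inr (Or.inr (by simpa using h)) }
  mul_le_mul := by
    rintro f₁ f₂ g h (rfl | hgh)
    · exact Or.inl rfl
    · right
      have := conj f₂⁻¹ _ hgh
      simpa [mul_assoc] using this

theorem IsBiOrder.comap {r : G → G → Prop} (hr : IsBiOrder r) (φ : H →* G)
    (hφ : Function.Injective φ) : IsBiOrder (fun u v => r (φ u) (φ v)) where
  isLinearOrder :=
    have := hr.isLinearOrder
    { refl := fun g => refl_of r _
      trans := fun _ _ _ => trans_of r
      antisymm := fun _ _ h h' => hφ (antisymm_of r h h')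
      total := fun a b => total_of r (φ a) (φ b) }
  mul_le_mul f₁ f₂ g h hgh := by simpa using hr.mul_le_mul (φ f₁) (φ f₂) _ _ hgh

theorem one_notMem_positiveCone {r : G → G → Prop} : (1 : G) ∉ positiveCone r := fun h => h.2 rfl

namespace IsBiOrder

variable {r : G → G → Prop} (hr : IsBiOrder r)
include hr

theorem refl (g : G) : r g g := have := hr.isLinearOrder; refl_of r g

theorem trans {a b c : G} (h : r a b) (h' : r b c) : r a c :=
  have := hr.isLinearOrder; trans_of r h h'

theorem antisymm {a b : G} (h : r a b) (h' : r b a) : a = b :=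
  have := hr.isLinearOrder; antisymm_of r h h'

theorem total (a b : G) : r a b ∨ r b a := have := hr.isLinearOrder; total_of r a b

theorem mul_mem {g h : G} (hg : g ∈ positiveCone r) (hh : h ∈ positiveCone r) :
    g * h ∈ positiveCone r := by
  have h1 : r g (g * h) := by simpa using hr.mul_le_mul g 1 _ _ hh.1
  refine ⟨hr.trans hg.1 h1, fun e => hg.2 ?_⟩
  rw [← e] at h1
  exact hr.antisymm hg.1 h1

theorem conj_mem (f : G) {g : G} (hg : g ∈ positiveCone r) : f * g * f⁻¹ ∈ positiveCone r :=
  ⟨by simpa using hr.mul_le_mul f f⁻¹ _ _ hg.1, fun e => hg.2 (conj_eq_one_iff.mp e.symm).symm⟩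

theorem mem_or_inv_mem {g : G} (hg : g ≠ 1) :
    g ∈ positiveCone r ∨ g⁻¹ ∈ positiveCone r := by
  rcases hr.total 1 g with h | h
  · exact Or.inl ⟨h, hg.symm⟩
  · exact Or.inr ⟨by simpa using hr.mul_le_mul g⁻¹ 1 _ _ h, fun e => hg (by simpa using e.symm)⟩

theorem mul_right {g h : G} (f : G) (hgh : r g h) : r (g * f) (h * f) := by
  simpa using hr.mul_le_mul 1 f _ _ hgh

theorem exists_max {s : Finset G} (hs : s.Nonempty) : ∃ m ∈ s, ∀ x ∈ s, r x m := by
  classical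
  induction hs using Finset.Nonempty.cons_induction with
  | singleton a => exact ⟨a, by simp, by simpa using hr.refl a⟩
  | cons a s ha hs ih =>
    obtain ⟨m, hm, hmax⟩ := ih
    rcases hr.total a m with h | h
    · exact ⟨m, by simp [hm], by simpa using ⟨h, hmax⟩⟩
    · exact ⟨a, by simp, by simpa using ⟨hr.refl a, fun x hx => hr.trans (hmax x hx) h⟩⟩

end IsBiOrder

end Cones

/-! ### The lexicographic bi-order on a wreath product -/

section WreathOrder

section

variable {A T : Type*} [CommGroup A]

@[simp] theorem coord_one (t : T) : coord (1 : Base A T) t = 1 := rfl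

@[simp] theorem coord_mul (f g : Base A T) (t : T) :
    coord (f * g) t = coord f t * coord g t := rfl

@[simp] theorem coord_inv (f : Base A T) (t : T) : coord f⁻¹ t = (coord f t)⁻¹ := rfl

theorem base_ext {f g : Base A T} (h : ∀ t, coord f t = coord g t) : f = g :=
  Multiplicative.toAdd.injective (Finsupp.ext h)

theorem coord_ofAdd_single [DecidableEq T] (s : T) (a : A) (t : T) :
    coord (Multiplicative.ofAdd (Finsupp.single s (Additive.ofMul a)) : Base A T) t =
      if s = t then a else 1 := by
  change (Finsupp.single s (Additive.ofMul a) t).toMul = _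
  rw [Finsupp.single_apply]
  split_ifs <;> rfl

end

variable {A T : Type*} [CommGroup A] [Group T]

@[simp] theorem coord_wreathAction (s : T) (f : Base A T) (t : T) :
    coord (wreathAction A T s f) t = coord f (t * s) := by
  change coord f (t * (s⁻¹)⁻¹) = _
  rw [inv_inv]

variable {rA : A → A → Prop} {rT : T → T → Prop}

/-- The greater of the two leading places leads the product. Only when the places coincide do two
coefficients meet, and then positivity in `A` is multiplicative. -/
theorem BasePositive.mul (hA : IsBiOrder rA) (hT : IsBiOrder rT) {f g : Base A T}
    (hf : BasePositive rA rT f) (hg : BasePositive rA rT g) : BasePositive rA rT (f * g) := by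
  obtain ⟨a, ha, ha'⟩ := hf
  obtain ⟨b, hb, hb'⟩ := hg
  have key : ∀ {c : T}, rT a c → rT b c → ∀ t, coord (f * g) t ≠ 1 → rT t c := by
    intro c hac hbc t ht
    by_cases h : coord f t = 1
    · exact hT.trans (hb' t fun h' => ht (by simp [h, h'])) hbc
    · exact hT.trans (ha' t h) hac
  by_cases hab : a = b
  · subst hab
    exact ⟨a, hA.mul_mem ha hb, key (hT.refl a) (hT.refl a)⟩
  rcases hT.total a b with h | h
  · have : coord f b = 1 := by
      by_contra h'
      exact hab (hT.antisymm h (ha' b h'))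
    exact ⟨b, by simpa [this] using hb, key h (hT.refl b)⟩
  · have : coord g a = 1 := by
      by_contra h'
      exact hab (hT.antisymm (hb' a h') h)
    exact ⟨a, by simpa [this] using ha, key (hT.refl a) h⟩

theorem BasePositive.wreathAction (hT : IsBiOrder rT) {f : Base A T}
    (hf : BasePositive rA rT f) (t : T) : BasePositive rA rT (BiOrd.wreathAction A T t f) := by
  obtain ⟨a, ha, ha'⟩ := hf
  refine ⟨a * t⁻¹, by simpa using ha, fun q hq => ?_⟩
  rw [coord_wreathAction] at hq
  simpa using hT.mul_right t⁻¹ (ha' _ hq)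

theorem basePositive_or_inv (hA : IsBiOrder rA) (hT : IsBiOrder rT) {f : Base A T}
    (hf : f ≠ 1) : BasePositive rA rT f ∨ BasePositive rA rT f⁻¹ := by
  have hs : (Multiplicative.toAdd f).support.Nonempty := by
    exact Finsupp.support_nonempty_iff.mpr fun h => hf (Multiplicative.toAdd.injective h)
  obtain ⟨m, hm, hmax⟩ := hT.exists_max hs
  have hmax' : ∀ t, coord f t ≠ 1 → rT t m := fun t ht => hmax t (Finsupp.mem_support_iff.mpr ht)
  have hm' : coord f m ≠ 1 := (Finsupp.mem_support_iff (f := Multiplicative.toAdd f)).mp hm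
  rcases hA.mem_or_inv_mem hm' with h | h
  · exact Or.inl ⟨m, h, hmax'⟩
  · exact Or.inr ⟨m, h, fun t ht => hmax' t (by simpa using ht)⟩

/-- For conjugation invariance, the base component of the conjugator cancels because the base is
abelian; only the translation by its `T`-component remains. -/
theorem lexOrder_isBiOrder (hA : IsBiOrder rA) (hT : IsBiOrder rT) :
    IsBiOrder (lexOrder rA rT) := by
  refine isBiOrder_of_cone (P := lexCone rA rT) ?_ ?_ ?_ ?_
  · rintro (h | ⟨-, a, ha, -⟩)
    · exact one_notMem_positiveCone h
    · exact one_notMem_positiveCone ha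
  · rintro g (hg | ⟨hg, hg'⟩) h (hh | ⟨hh, hh'⟩)
    · exact Or.inl (hT.mul_mem hg hh)
    · exact Or.inl (by simpa [hh] using hg)
    · exact Or.inl (by simpa [hg] using hh)
    · exact Or.inr ⟨by simp [hg, hh], by simpa [hg] using hg'.mul hA hT hh'⟩
  · rintro f g (hg | ⟨hg, hg'⟩)
    · exact Or.inl (by simpa using hT.conj_mem f.right hg)
    · refine Or.inr ⟨by simp [hg], ?_⟩
      have : (f * g * f⁻¹).left = wreathAction A T f.right g.left := by
        simp [hg, mul_comm f.left]
      rw [this]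
      exact hg'.wreathAction hT _
  · intro g hg
    by_cases h : g.right = 1
    · have hl : g.left ≠ 1 := fun h' => hg (SemidirectProduct.ext h' h)
      rcases basePositive_or_inv hA hT hl with h' | h'
      · exact Or.inl (Or.inr ⟨h, h'⟩)
      · exact Or.inr (Or.inr ⟨by simp [h], by simpa [h] using h'⟩)
    · rcases hT.mem_or_inv_mem h with h' | h'
      · exact Or.inl (Or.inl h')
      · exact Or.inr (Or.inl h')

theorem lexOrder_one_iff {g h : Wreath A T} :
    lexOrder rA rT g h ↔ lexOrder rA rT 1 (g⁻¹ * h) := by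
  simp [lexOrder, eq_comm (a := (1 : Wreath A T)), inv_mul_eq_one]

theorem positiveCone_lexOrder :
    positiveCone (lexOrder rA rT) = lexCone rA rT := by
  ext g
  have : (1 : Wreath A T) ∉ lexCone rA rT := by
    rintro (h | ⟨-, a, ha, -⟩)
    · exact one_notMem_positiveCone h
    · exact one_notMem_positiveCone ha
  constructor
  · rintro ⟨h | h, h'⟩
    · exact absurd h h'
    · simpa using h
  · intro h
    exact ⟨Or.inr (by simpa using h), by rintro rfl; exact this h⟩

end WreathOrder

/-! ### The lexicographic order on `ℤⁿ` -/

section Lex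

variable {n : ℕ}

/-- The lexicographic order on `ℤⁿ`. -/
def lexLE (f g : FreeAb n) : Prop := toLex f.toAdd ≤ toLex g.toAdd

theorem lexLE_isBiOrder : IsBiOrder (lexLE (n := n)) where
  isLinearOrder :=
    { refl := fun g => le_refl (toLex g.toAdd)
      trans := fun _ _ _ h h' => le_trans (α := Lex (Fin n → ℤ)) h h'
      antisymm := fun _ _ h h' => le_antisymm (α := Lex (Fin n → ℤ)) h h'
      total := fun a b => le_total (toLex a.toAdd) (toLex b.toAdd) }
  mul_le_mul f₁ f₂ _ _ hgh :=
    add_le_add_left (α := Lex (Fin n → ℤ)) (add_le_add_right (α := Lex (Fin n → ℤ)) hgh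
      (toLex f₁.toAdd)) (toLex f₂.toAdd)

theorem lexLE_iff {f g : FreeAb n} : lexLE f g ↔ f = g ∨
    ∃ i, (∀ j < i, f.toAdd j = g.toAdd j) ∧ f.toAdd i < g.toAdd i := by
  rw [lexLE, le_iff_eq_or_lt]
  exact Iff.rfl

theorem mem_positiveCone_lexLE {f : FreeAb n} : f ∈ positiveCone (lexLE (n := n)) ↔
    ∃ i, (∀ j < i, f.toAdd j = 0) ∧ 0 < f.toAdd i := by
  have : f ∈ positiveCone (lexLE (n := n)) ↔ toLex 0 < toLex f.toAdd := by
    exact (lt_iff_le_and_ne (α := Lex (Fin n → ℤ))).symm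
  rw [this]
  change (∃ i, (∀ j < i, 0 = f.toAdd j) ∧ 0 < f.toAdd i) ↔ _
  simp only [eq_comm]

end Lex

/-! ### `ℤⁿ` as the abelianization of the free group -/

section FreeAb

variable {n : ℕ} {C : Type*} [CommGroup C]

/-- The homomorphism from `ℤⁿ` to a commutative group with prescribed values on the basis. -/
def FreeAb.lift (c : Fin n → C) : FreeAb n →* C where
  toFun f := ∏ i, c i ^ f.toAdd i
  map_one' := by simp
  map_mul' f g := by simp [zpow_add, Finset.prod_mul_distrib]

theorem FreeAb.lift_apply (c : Fin n → C) (f : FreeAb n) :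
    FreeAb.lift c f = ∏ i, c i ^ f.toAdd i := rfl

@[simp] theorem FreeAb.lift_basis (c : Fin n → C) (i : Fin n) :
    FreeAb.lift c (FreeAb.basis i) = c i := by
  rw [lift_apply, Finset.prod_eq_single i]
  · simp [basis]
  · intro j _ hj
    simp [basis, hj]
  · simp

theorem FreeAb.prod_basis_zpow (f : FreeAb n) : ∏ i, basis i ^ f.toAdd i = f := by
  apply Multiplicative.toAdd.injective
  ext j
  simp [basis, toAdd_prod, Finset.sum_apply, Pi.single_apply]

/-- The abelianization map `F_n → ℤⁿ`. -/
def toFreeAb (n : ℕ) : FreeGroup (Fin n) →* FreeAb n := FreeGroup.lift FreeAb.basis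

@[simp] theorem toFreeAb_of (i : Fin n) : toFreeAb n (FreeGroup.of i) = FreeAb.basis i :=
  FreeGroup.lift_apply_of ..

theorem toFreeAb_surjective : Function.Surjective (toFreeAb n) := by
  intro f
  obtain ⟨w, hw⟩ := QuotientGroup.mk_surjective (s := commutator (FreeGroup (Fin n)))
    (FreeAb.lift (fun i => Abelianization.of (FreeGroup.of i)) f)
  refine ⟨w, ?_⟩
  have : toFreeAb n w = Abelianization.lift (toFreeAb n) (Abelianization.of w) := by simp
  rw [this]
  change Abelianization.lift (toFreeAb n) (QuotientGroup.mk w) = f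
  rw [hw, FreeAb.lift_apply, map_prod]
  simp [FreeAb.prod_basis_zpow]

/-- The abelianization map factors through `toFreeAb`, by the universal property of the basis of
`ℤⁿ`. -/
theorem ker_toFreeAb : (toFreeAb n).ker = commutator (FreeGroup (Fin n)) := by
  apply le_antisymm
  · intro w hw
    have h : (FreeAb.lift fun i => Abelianization.of (FreeGroup.of i)).comp (toFreeAb n) =
        Abelianization.of := by
      ext i
      simp
    rw [← Abelianization.ker_of, MonoidHom.mem_ker, ← h, MonoidHom.comp_apply,
      MonoidHom.mem_ker.mp hw, map_one]
  · exact Abelianization.commutator_subset_ker _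

end FreeAb

/-! ### Homomorphisms on the base group, and metabelianity of the wreath product -/

section Base

variable {A T C : Type*} [CommGroup A] [CommGroup C]

/-- The homomorphism on the base group with prescribed values on the coordinate subgroups. -/
noncomputable def Base.lift (c : T → A →* C) : Base A T →* C :=
  AddMonoidHom.toMultiplicativeLeft (Finsupp.liftAddHom fun t => (c t).toAdditive)

theorem Base.lift_single (c : T → A →* C) (t : T) (a : A) :
    Base.lift c (Multiplicative.ofAdd (Finsupp.single t (Additive.ofMul a))) = c t a := by
  simp [Base.lift]

theorem wreathAction_single {T : Type*} [Group T] (s t : T) (a : A) :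
    wreathAction A T s (Multiplicative.ofAdd (Finsupp.single t (Additive.ofMul a))) =
      Multiplicative.ofAdd (Finsupp.single (t * s⁻¹) (Additive.ofMul a)) := by
  classical
  apply base_ext
  intro q
  simp [coord_ofAdd_single, mul_inv_eq_iff_eq_mul]

/-- Commutators die in the commutative quotient `T`, so they lie in the base, which is abelian. -/
theorem derivedSeries_wreath {T : Type*} [CommGroup T] : derivedSeries (Wreath A T) 2 = ⊥ := by
  have h : ∀ g ∈ derivedSeries (Wreath A T) 1, g.right = 1 := by
    intro g hg
    rw [derivedSeries_one] at hg
    exact Abelianization.commutator_subset_ker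
      (SemidirectProduct.rightHom : Wreath A T →* T) hg
  rw [eq_bot_iff, derivedSeries_succ, Subgroup.commutator_le]
  intro g hg k hk
  rw [Subgroup.mem_bot, commutatorElement_eq_one_iff_mul_comm]
  ext1
  · simp [h g hg, h k hk, mul_comm]
  · simp [h g hg, h k hk]

end Base

/-! ### The Magnus embedding -/

section Magnus

variable {n : ℕ}

/-- The Magnus homomorphism on the free group. -/
noncomputable def magnusFree (n : ℕ) : FreeGroup (Fin n) →* Wreath (FreeAb n) (FreeAb n) :=
  FreeGroup.lift fun i => Wreath.ofA (FreeAb.basis i) * Wreath.ofT (FreeAb.basis i)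

@[simp] theorem magnusFree_of (i : Fin n) : magnusFree n (FreeGroup.of i) =
    Wreath.ofA (FreeAb.basis i) * Wreath.ofT (FreeAb.basis i) :=
  FreeGroup.lift_apply_of ..

theorem magnusFree_right (w : FreeGroup (Fin n)) : (magnusFree n w).right = toFreeAb n w := by
  have : SemidirectProduct.rightHom.comp (magnusFree n) = toFreeAb n := by
    ext1 i
    simp [Wreath.ofA, Wreath.ofT]
  exact DFunLike.congr_fun this w

/-- The Magnus homomorphism. -/
noncomputable def magnus (n : ℕ) : FreeMetabelian n →* Wreath (FreeAb n) (FreeAb n) :=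
  QuotientGroup.lift _ (magnusFree n) fun w hw => by
    have := map_derivedSeries_le_derivedSeries (magnusFree n) 2 (Subgroup.mem_map_of_mem _ hw)
    rwa [derivedSeries_wreath] at this

theorem magnus_isMagnus : IsMagnus (magnus n) := fun i => magnusFree_of i

/-- A set-theoretic section of the abelianization map. -/
noncomputable def freeSection (t : FreeAb n) : FreeGroup (Fin n) :=
  Function.surjInv toFreeAb_surjective t

@[simp] theorem toFreeAb_freeSection (t : FreeAb n) : toFreeAb n (freeSection t) = t :=
  Function.surjInv_eq _ t

/-- The loop at the base point which first follows the section to `q`, then the path `w`, and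
returns along the section. -/
noncomputable def loop (q : FreeAb n) (w : FreeGroup (Fin n)) : commutator (FreeGroup (Fin n)) :=
  ⟨freeSection q * w * (freeSection (q * toFreeAb n w))⁻¹, by
    rw [← ker_toFreeAb, MonoidHom.mem_ker]
    simp⟩

theorem loop_mul (q : FreeAb n) (v w : FreeGroup (Fin n)) :
    loop q (v * w) = loop q v * loop (q * toFreeAb n v) w := by
  apply Subtype.ext
  simp [loop, mul_assoc]

theorem loop_one (q : FreeAb n) : loop q 1 = 1 := by
  apply Subtype.ext
  simp [loop]

/-- The homomorphism sending the edge of the Cayley graph at the coordinate `t` to the class of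
its loop. -/
noncomputable def edgeLoop (n : ℕ) :
    Base (FreeAb n) (FreeAb n) →* Abelianization (commutator (FreeGroup (Fin n))) :=
  Base.lift fun t => FreeAb.lift fun i => Abelianization.of (loop t⁻¹ (FreeGroup.of i))

/-- Both sides satisfy the same cocycle rule in `w`, with `q` moving along the path, so it suffices
to compare them on generators. The action places the edge leaving the vertex `q` at the coordinate
`q⁻¹`, which explains the inverse in `edgeLoop`. -/
theorem edgeLoop_magnusFree (w : FreeGroup (Fin n)) (q : FreeAb n) :
    edgeLoop n (wreathAction _ _ q (magnusFree n w).left) = Abelianization.of (loop q w) := by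
  have hmul : ∀ (v w : FreeGroup (Fin n)) (q : FreeAb n),
      edgeLoop n (wreathAction _ _ q (magnusFree n (v * w)).left) =
        edgeLoop n (wreathAction _ _ q (magnusFree n v).left) *
        edgeLoop n (wreathAction _ _ (q * toFreeAb n v) (magnusFree n w).left) := by
    intro v w q
    rw [map_mul, SemidirectProduct.mul_left, map_mul, map_mul, magnusFree_right, map_mul,
      MulAut.mul_apply]
  induction w using FreeGroup.induction_on generalizing q with
  | C1 => simp [loop_one]
  | of i =>
    simp [Wreath.ofA, Wreath.ofT, wreathAction_single, edgeLoop, Base.lift_single]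
  | inv_of i ih =>
    -- The value at an inverse generator is forced by the cocycle rule applied to `x⁻¹ * x = 1`.
    have h1 := hmul (FreeGroup.of i)⁻¹ (FreeGroup.of i) q
    have h2 := congrArg Abelianization.of (loop_mul q (FreeGroup.of i)⁻¹ (FreeGroup.of i))
    rw [map_mul, ← ih] at h2
    rw [inv_mul_cancel] at h1 h2
    rw [loop_one, map_one] at h2
    simp only [map_one, SemidirectProduct.one_left] at h1
    exact mul_right_cancel (h1.symm.trans h2)
  | mul v w hv hw => rw [hmul, hv, hw, loop_mul, map_mul]

theorem magnus_injective : Function.Injective (magnus n) := by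
  rw [injective_iff_map_eq_one]
  intro g hg
  obtain ⟨w, rfl⟩ := QuotientGroup.mk_surjective g
  replace hg : magnusFree n w = 1 := hg
  rw [QuotientGroup.eq_one_iff]
  have h1 : toFreeAb n w = 1 := by rw [← magnusFree_right, hg]; rfl
  have h2 := edgeLoop_magnusFree w 1
  rw [hg] at h2
  have h3 : loop 1 w ∈ commutator (commutator (FreeGroup (Fin n))) := by
    have h4 : loop 1 w ∈ Abelianization.of.ker := by
      rw [MonoidHom.mem_ker, ← h2]
      simp
    rwa [Abelianization.ker_of] at h4
  have h4 : (loop 1 w : FreeGroup (Fin n)) ∈ derivedSeries (FreeGroup (Fin n)) 2 := by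
    rw [derivedSeries_succ, derivedSeries_one, ← Subgroup.map_subtype_commutator]
    exact Subgroup.mem_map_of_mem (Subgroup.subtype _) h3
  -- The section need not send 1 to 1, so the loop is only a conjugate of `w`; normality of `F_n''`
  -- removes the conjugation.
  have h5 := (derivedSeries_normal (FreeGroup (Fin n)) 2).conj_mem _ h4 (freeSection 1)⁻¹
  simpa [loop, h1, mul_assoc] using h5

/-- The lexicographic bi-order on `M_n` induced by the Magnus homomorphism. -/
def magnusOrder (u v : FreeMetabelian n) : Prop :=
  lexOrder lexLE lexLE (magnus n u) (magnus n v)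

theorem magnusOrder_isBiOrder : IsBiOrder (magnusOrder (n := n)) :=
  (lexOrder_isBiOrder lexLE_isBiOrder lexLE_isBiOrder).comap (magnus n) magnus_injective

end Magnus

/-! ### Words and change of generating family -/

section Words

variable {G : Type*} [Group G] {k : ℕ} (s : Fin k → G)

@[simp] theorem eval_nil : eval s [] = 1 := rfl

theorem eval_cons (l : Fin k × Bool) (w : Word k) :
    eval s (l :: w) = eval s [l] * eval s w := by simp [eval]

@[simp] theorem eval_append (v w : Word k) : eval s (v ++ w) = eval s v * eval s w := by
  simp [eval]

theorem eval_singleton (l : Fin k × Bool) :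
    eval s [l] = if l.2 then s l.1 else (s l.1)⁻¹ := by simp [eval]

/-- The formal inverse of a word. -/
def invWord (w : Word k) : Word k := (w.map fun l => (l.1, !l.2)).reverse

@[simp] theorem eval_invWord (w : Word k) : eval s (invWord w) = (eval s w)⁻¹ := by
  induction w with
  | nil => simp [invWord]
  | cons l w ih =>
    have : invWord (l :: w) = invWord w ++ [(l.1, !l.2)] := by simp [invWord]
    rw [this, eval_append, ih, eval_cons s l w, mul_inv_rev]
    rcases l with ⟨i, _ | _⟩ <;> simp [eval_singleton]

variable {s}

theorem Generates.exists_word (hs : Generates s) (g : G) : ∃ w, eval s w = g := by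
  have hg : g ∈ Subgroup.closure (Set.range s) := by
    rw [show Subgroup.closure (Set.range s) = ⊤ from hs]
    trivial
  induction hg using Subgroup.closure_induction with
  | mem x hx =>
    obtain ⟨i, rfl⟩ := hx
    exact ⟨[(i, true)], by simp [eval_singleton]⟩
  | one => exact ⟨[], rfl⟩
  | mul x y _ _ hx hy =>
    obtain ⟨v, rfl⟩ := hx
    obtain ⟨w, rfl⟩ := hy
    exact ⟨v ++ w, eval_append s v w⟩
  | inv x _ hx =>
    obtain ⟨v, rfl⟩ := hx
    exact ⟨invWord v, eval_invWord s v⟩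

/-- The letters of one generating family can be replaced by words over another one. -/
theorem Generates.exists_substitution {m : ℕ} (hs : Generates s) (t : Fin m → G) :
    ∃ f : Fin m × Bool → Word k, ∀ w, eval t w = eval s (w.flatMap f) := by
  choose f hf using fun l : Fin m × Bool => hs.exists_word (eval t [l])
  refine ⟨f, fun w => ?_⟩
  induction w with
  | nil => rfl
  | cons l w ih => rw [eval_cons, ih, List.flatMap_cons, eval_append, hf]

end Words

theorem FreeMetabelian.generates_gen (n : ℕ) :
    Generates (FreeMetabelian.gen : Fin n → FreeMetabelian n) := by
  have : Set.range (FreeMetabelian.gen : Fin n → FreeMetabelian n) =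
      QuotientGroup.mk' (derivedSeries (FreeGroup (Fin n)) 2) '' Set.range FreeGroup.of := by
    rw [← Set.range_comp]
    rfl
  rw [Generates, this, ← MonoidHom.map_closure, FreeGroup.closure_range_of]
  exact Subgroup.map_top_of_surjective _ (QuotientGroup.mk'_surjective _)

/-! ### Primitive recursive integer arithmetic -/

section IntPrimrec

open Encodable

theorem encode_natCast_int (a : ℕ) : encode (a : ℤ) = 2 * a := rfl

theorem encode_negSucc_int (a : ℕ) : encode (Int.negSucc a) = 2 * a + 1 := rfl

/-- The code of an integer carries its sign in the parity, and halving the code recovers the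
magnitude. The other integer operations then reduce to natural arithmetic on positive and negative
parts. -/
theorem primrec_int_toNat : Primrec Int.toNat :=
  (Primrec.cond (Primrec.nat_bodd.comp Primrec.encode) (Primrec.const 0)
    (Primrec.nat_div2.comp Primrec.encode)).of_eq fun z => by
      rcases z with a | a
      · rw [Int.ofNat_eq_natCast, encode_natCast_int]
        simp [Nat.bodd_mul, Nat.div2_val]
      · rw [encode_negSucc_int]
        simp [Nat.bodd_mul]

theorem primrec_int_neg_toNat : Primrec fun z : ℤ => (-z).toNat :=
  (Primrec.cond (Primrec.nat_bodd.comp Primrec.encode)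
    (Primrec.succ.comp (Primrec.nat_div2.comp Primrec.encode)) (Primrec.const 0)).of_eq
    fun z => by
      rcases z with a | a
      · rw [Int.ofNat_eq_natCast, encode_natCast_int]
        simp [Nat.bodd_mul]
      · rw [encode_negSucc_int]
        simp [Nat.bodd_mul, Nat.div2_val, Int.negSucc_eq]

theorem primrec_int_natCast_sub : Primrec₂ fun a b : ℕ => (a : ℤ) - b := by
  have hfst : Primrec fun p : ℕ × ℕ => p.1 := Primrec.fst
  have hsnd : Primrec fun p : ℕ × ℕ => p.2 := Primrec.snd
  refine Primrec.encode_iff.mp ((Primrec.ite (Primrec.nat_le.comp hsnd hfst)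
    (Primrec.nat_double.comp (Primrec.nat_sub.comp hfst hsnd))
    (Primrec.nat_double_succ.comp
      (Primrec.pred.comp (Primrec.nat_sub.comp hsnd hfst)))).of_eq fun p => ?_)
  split_ifs with h
  · dsimp only
    rw [← Nat.cast_sub h, encode_natCast_int]
  · have : (p.1 : ℤ) - p.2 = Int.negSucc (p.2 - p.1).pred := by
      rw [Int.negSucc_eq, Nat.pred_eq_sub_one]
      omega
    dsimp only
    rw [this, encode_negSucc_int]

theorem primrec_int_add : Primrec₂ fun a b : ℤ => a + b :=
  (primrec_int_natCast_sub.comp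
    (Primrec.nat_add.comp (primrec_int_toNat.comp Primrec.fst)
      (primrec_int_toNat.comp Primrec.snd))
    (Primrec.nat_add.comp (primrec_int_neg_toNat.comp Primrec.fst)
      (primrec_int_neg_toNat.comp Primrec.snd))).of_eq fun p => by
    push_cast
    omega

theorem primrec_int_neg : Primrec fun a : ℤ => -a :=
  (primrec_int_natCast_sub.comp primrec_int_neg_toNat primrec_int_toNat).of_eq fun a => by
    omega

theorem primrecRel_int_lt : PrimrecRel fun a b : ℤ => a < b :=
  PrimrecPred.of_eq (Primrec.nat_lt.comp
    (Primrec.nat_add.comp (primrec_int_toNat.comp Primrec.fst)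
      (primrec_int_neg_toNat.comp Primrec.snd))
    (Primrec.nat_add.comp (primrec_int_toNat.comp Primrec.snd)
      (primrec_int_neg_toNat.comp Primrec.fst))) fun p => by omega

end IntPrimrec

/-! ### Primitive recursive predicates on integer vectors -/

section PrimrecPi

variable {α σ : Type*} [Primcodable α] [Primcodable σ] {n : ℕ}

theorem primrec_pi {f : α → Fin n → σ} (h : ∀ i, Primrec fun a => f a i) : Primrec f :=
  Primrec.fin_curry.mpr (Primrec₂.swap (Primrec.fin_curry₁.mpr h))

theorem primrec_apply {f : α → Fin n → σ} (h : Primrec f) (i : Fin n) :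
    Primrec fun a => f a i :=
  Primrec.fin_app.comp h (Primrec.const i)

theorem primrecPred_const (p : Prop) : PrimrecPred fun _ : α => p := by
  classical
  exact ⟨inferInstance, Primrec.const (decide p)⟩

theorem primrecPred_forall_finset {ι : Type*} (s : Finset ι) {p : ι → α → Prop}
    (h : ∀ i, PrimrecPred (p i)) : PrimrecPred fun a => ∀ i ∈ s, p i a := by
  classical
  induction s using Finset.induction_on with
  | empty => simpa using primrecPred_const True
  | insert i s _ ih => exact ((h i).and ih).of_eq fun a => by simp

theorem primrecPred_forall {ι : Type*} [Fintype ι] {p : ι → α → Prop}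
    (h : ∀ i, PrimrecPred (p i)) : PrimrecPred fun a => ∀ i, p i a :=
  (primrecPred_forall_finset Finset.univ h).of_eq fun a => by simp

theorem primrecPred_exists {ι : Type*} [Fintype ι] {p : ι → α → Prop}
    (h : ∀ i, PrimrecPred (p i)) : PrimrecPred fun a => ∃ i, p i a :=
  (primrecPred_forall fun i => (h i).not).not.of_eq fun a => by simp

theorem primrecRel_lexLE : PrimrecRel fun f g : Fin n → ℤ =>
    lexLE (Multiplicative.ofAdd f) (Multiplicative.ofAdd g) := by
  have h (i : Fin n) := primrec_apply (Primrec.fst (α := Fin n → ℤ) (β := Fin n → ℤ)) i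
  have h' (i : Fin n) := primrec_apply (Primrec.snd (α := Fin n → ℤ) (β := Fin n → ℤ)) i
  refine PrimrecPred.of_eq ((Primrec.eq.comp Primrec.fst Primrec.snd).or
    (primrecPred_exists fun i => (primrecPred_forall fun j =>
      (primrecPred_const (j < i)).not.or (Primrec.eq.comp (h j) (h' j))).and
      (primrecRel_int_lt.comp (h i) (h' i)))) fun p => ?_
  dsimp only
  rw [lexLE_iff]
  simp only [imp_iff_not_or]
  rfl

theorem primrecPred_mem_positiveCone : PrimrecPred fun f : Fin n → ℤ =>
    Multiplicative.ofAdd f ∈ positiveCone (lexLE (n := n)) :=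
  ((primrecRel_lexLE.comp (Primrec.const (0 : Fin n → ℤ)) Primrec.id).and
    (Primrec.eq.comp (Primrec.const (0 : Fin n → ℤ)) Primrec.id).not).of_eq fun _ => Iff.rfl

end PrimrecPi

/-! ### Reading the Magnus image from a word -/

section Trace

variable {n : ℕ}

/-- The displacement of the coordinate caused by a letter. -/
def displacement (l : Fin n × Bool) : Fin n → ℤ := Pi.single l.1 (if l.2 then -1 else 1)

/-- The coordinate of the base group to which a letter contributes, relative to the coordinate at
its start. -/
def offset (l : Fin n × Bool) : Fin n → ℤ := if l.2 then 0 else displacement l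

/-- One step in reading a word: the coordinate at the end, and the list of all contributions to
the base group. -/
def traceStep (st : (Fin n → ℤ) × List ((Fin n → ℤ) × Fin n × Bool)) (l : Fin n × Bool) :
    (Fin n → ℤ) × List ((Fin n → ℤ) × Fin n × Bool) :=
  (st.1 + displacement l, (st.1 + offset l, l) :: st.2)

/-- The coordinate at the end of a word, and its contributions to the base group. -/
def trace (w : Word n) : (Fin n → ℤ) × List ((Fin n → ℤ) × Fin n × Bool) :=
  w.foldl traceStep (0, [])

/-- The total contribution to one coordinate. -/
def flow (L : List ((Fin n → ℤ) × Fin n × Bool)) (q : Fin n → ℤ) : Fin n → ℤ :=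
  fun i => (L.count (q, i, true) : ℤ) - L.count (q, i, false)

theorem primrec_pi_add {α : Type*} [Primcodable α] {f g : α → Fin n → ℤ} (hf : Primrec f)
    (hg : Primrec g) : Primrec fun a => f a + g a :=
  primrec_pi fun i => primrec_int_add.comp (primrec_apply hf i) (primrec_apply hg i)

theorem primrec_trace : Primrec (trace (n := n)) := by
  have h1 : Primrec fun x : Word n × ((Fin n → ℤ) × List ((Fin n → ℤ) × Fin n × Bool)) ×
      (Fin n × Bool) => x.2.1.1 := Primrec.fst.comp (Primrec.fst.comp Primrec.snd)
  have h2 : Primrec fun x : Word n × ((Fin n → ℤ) × List ((Fin n → ℤ) × Fin n × Bool)) ×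
      (Fin n × Bool) => x.2.2 := Primrec.snd.comp Primrec.snd
  refine Primrec.list_foldl (h := fun _ x => traceStep x.1 x.2) Primrec.id
    (Primrec.const (0, [])) (Primrec.pair
    (primrec_pi_add h1 ((Primrec.dom_finite _).comp h2)) (Primrec.list_cons.comp (Primrec.pair
      (primrec_pi_add h1 ((Primrec.dom_finite _).comp h2)) h2)
      (Primrec.snd.comp (Primrec.fst.comp Primrec.snd))))

theorem primrec_list_count {α : Type*} [Primcodable α] [BEq α] [LawfulBEq α] :
    Primrec₂ fun (L : List α) (a : α) => L.count a := by
  classical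
  refine (Primrec.list_length.comp (PrimrecRel.listFilter (Primrec.eq (α := α)))).of_eq
    fun p => ?_
  dsimp only
  rw [List.count_eq_length_filter]
  refine congrArg List.length (List.filter_congr fun a _ => ?_)
  rw [Bool.eq_iff_iff]
  simp

theorem primrec_flow : Primrec₂ (flow (n := n)) := by
  refine primrec_pi fun i => primrec_int_natCast_sub.comp
    (primrec_list_count.comp Primrec.fst (Primrec.pair Primrec.snd (Primrec.const (i, true))))
    (primrec_list_count.comp Primrec.fst (Primrec.pair Primrec.snd (Primrec.const (i, false))))

theorem trace_concat (w : Word n) (l : Fin n × Bool) :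
    trace (w ++ [l]) = traceStep (trace w) l := by simp [trace]

theorem flow_cons (e : (Fin n → ℤ) × Fin n × Bool) (L : List ((Fin n → ℤ) × Fin n × Bool))
    (q : Fin n → ℤ) : flow (e :: L) q = flow L q +
      if e.1 = q then - displacement e.2 else 0 := by
  obtain ⟨p, i, b⟩ := e
  ext j
  by_cases hp : p = q
  · subst hp
    by_cases hi : i = j
    · subst hi
      cases b <;> simp [flow, displacement] <;> ring
    · have : j ≠ i := fun h => hi h.symm
      cases b <;> simp [flow, displacement, hi, this]
  · simp [flow, hp]

/-- The sign is reversed because `trace` follows coordinates of the base, and these are the inverses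
of the vertices of the path. -/
theorem magnus_letter_right (l : Fin n × Bool) :
    (magnus n (eval FreeMetabelian.gen [l])).right = Multiplicative.ofAdd (-displacement l) := by
  obtain ⟨i, _ | _⟩ := l <;> rw [eval_singleton]
  · simp [magnus_isMagnus i, Wreath.ofA, Wreath.ofT, displacement, FreeAb.basis]
  · simp [magnus_isMagnus i, Wreath.ofA, Wreath.ofT, displacement, FreeAb.basis, ← Pi.single_neg]

/-- An inverse letter `(a t)⁻¹ = t⁻¹ a⁻¹` moves before it contributes, so its coordinate is the one
after the step; a positive letter contributes before moving. -/
theorem coord_magnus_letter_left (l : Fin n × Bool) (q : Fin n → ℤ) :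
    coord (magnus n (eval FreeMetabelian.gen [l])).left (Multiplicative.ofAdd q) =
      Multiplicative.ofAdd (if offset l = q then -displacement l else 0) := by
  obtain ⟨i, _ | _⟩ := l <;> rw [eval_singleton]
  · have : offset (i, false) = q ↔ 1 = Multiplicative.ofAdd q * (FreeAb.basis i)⁻¹ := by
      rw [eq_mul_inv_iff_mul_eq, one_mul]
      simp [offset, displacement, FreeAb.basis]
    rw [if_neg Bool.false_ne_true, map_inv, magnus_isMagnus i, mul_inv_rev]
    simp only [Wreath.ofA, Wreath.ofT, ← map_inv, SemidirectProduct.mul_left,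
      SemidirectProduct.left_inr, SemidirectProduct.right_inr, SemidirectProduct.left_inl,
      one_mul, coord_wreathAction, coord_inv, coord_ofAdd_single, this]
    split_ifs <;> simp [displacement, FreeAb.basis, ← ofAdd_neg, ← Pi.single_neg]
  · have : offset (i, true) = q ↔ 1 = Multiplicative.ofAdd q := Iff.rfl
    simp [magnus_isMagnus i, Wreath.ofA, Wreath.ofT, coord_ofAdd_single, this]
    split_ifs <;> simp [displacement, FreeAb.basis, ← Pi.single_neg]

theorem magnus_eval_right (w : Word n) :
    (magnus n (eval FreeMetabelian.gen w)).right = Multiplicative.ofAdd (-(trace w).1) := by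
  induction w using List.reverseRecOn with
  | nil => simp [trace]
  | append_singleton w l ih =>
    rw [eval_append, map_mul, SemidirectProduct.mul_right, ih, magnus_letter_right,
      trace_concat, traceStep, ← ofAdd_add, neg_add]

theorem coord_magnus_eval_left (w : Word n) (q : Fin n → ℤ) :
    coord (magnus n (eval FreeMetabelian.gen w)).left (Multiplicative.ofAdd q) =
      Multiplicative.ofAdd (flow (trace w).2 q) := by
  induction w using List.reverseRecOn with
  | nil =>
    simp [trace]
    rfl
  | append_singleton w l ih =>
    rw [eval_append, map_mul, SemidirectProduct.mul_left, coord_mul, ih, coord_wreathAction,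
      magnus_eval_right, ← ofAdd_add, coord_magnus_letter_left, trace_concat, traceStep,
      flow_cons, ofAdd_add]
    simp only [← sub_eq_add_neg, eq_sub_iff_add_eq, add_comm]

/-- This bounds the search: the support of the base component lies in the recorded list. -/
theorem exists_mem_of_flow_ne_zero {L : List ((Fin n → ℤ) × Fin n × Bool)} {q : Fin n → ℤ}
    (h : flow L q ≠ 0) : ∃ e ∈ L, e.1 = q := by
  by_contra! h'
  apply h
  ext i
  have (b : Bool) : L.count (q, i, b) = 0 := List.count_eq_zero.mpr fun hm => h' _ hm rfl
  simp [flow, this]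

/-- The decision procedure for the order. -/
def TraceNonneg (t : (Fin n → ℤ) × List ((Fin n → ℤ) × Fin n × Bool)) : Prop :=
  Multiplicative.ofAdd (-t.1) ∈ positiveCone (lexLE (n := n)) ∨ (t.1 = 0 ∧
    ((∀ e ∈ t.2, flow t.2 e.1 = 0) ∨
      ∃ e ∈ t.2, Multiplicative.ofAdd (flow t.2 e.1) ∈ positiveCone (lexLE (n := n)) ∧
        ∀ e' ∈ t.2, flow t.2 e'.1 = 0 ∨
          lexLE (Multiplicative.ofAdd e'.1) (Multiplicative.ofAdd e.1)))

/-- Every quantifier in the criterion ranges over the recorded list, so bounded quantification over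
lists applies. -/
theorem primrecPred_traceNonneg : PrimrecPred (TraceNonneg (n := n)) := by
  have hflow : PrimrecRel fun (e : (Fin n → ℤ) × Fin n × Bool)
      (L : List ((Fin n → ℤ) × Fin n × Bool)) => flow L e.1 = 0 :=
    Primrec.eq.comp (primrec_flow.comp Primrec.snd (Primrec.fst.comp Primrec.fst))
      (Primrec.const _)
  have hmax : PrimrecRel fun (e' : (Fin n → ℤ) × Fin n × Bool)
      (p : ((Fin n → ℤ) × Fin n × Bool) × List ((Fin n → ℤ) × Fin n × Bool)) =>
      flow p.2 e'.1 = 0 ∨ lexLE (Multiplicative.ofAdd e'.1) (Multiplicative.ofAdd p.1.1) :=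
    (hflow.comp Primrec.fst (Primrec.snd.comp Primrec.snd)).or
      (primrecRel_lexLE.comp (Primrec.fst.comp Primrec.fst)
        (Primrec.fst.comp (Primrec.fst.comp Primrec.snd)))
  have hlead : PrimrecRel fun (e : (Fin n → ℤ) × Fin n × Bool)
      (L : List ((Fin n → ℤ) × Fin n × Bool)) =>
      Multiplicative.ofAdd (flow L e.1) ∈ positiveCone (lexLE (n := n)) ∧
        ∀ e' ∈ L, flow L e'.1 = 0 ∨
          lexLE (Multiplicative.ofAdd e'.1) (Multiplicative.ofAdd e.1) :=
    (primrecPred_mem_positiveCone.comp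
      (primrec_flow.comp Primrec.snd (Primrec.fst.comp Primrec.fst))).and
      ((hmax.forall_mem_list).comp Primrec.snd Primrec.id)
  have hneg : Primrec fun t : (Fin n → ℤ) × List ((Fin n → ℤ) × Fin n × Bool) => -t.1 :=
    primrec_pi fun i => primrec_int_neg.comp (primrec_apply Primrec.fst i)
  exact (primrecPred_mem_positiveCone.comp hneg).or
    ((Primrec.eq.comp Primrec.fst (Primrec.const _)).and
      ((hflow.forall_mem_list.comp Primrec.snd Primrec.snd).or
        (hlead.exists_mem_list.comp Primrec.snd Primrec.snd)))

/-- Quantifiers over all coordinates may be restricted to listed ones, since unlisted coordinates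
are trivial. -/
theorem magnusOrder_one_iff (w : Word n) :
    magnusOrder 1 (eval FreeMetabelian.gen w) ↔ TraceNonneg (trace w) := by
  have hr := magnus_eval_right w
  have hl := coord_magnus_eval_left w
  rw [magnusOrder, map_one, lexOrder, inv_one, one_mul]
  generalize magnus n (eval FreeMetabelian.gen w) = g at hr hl
  generalize trace w = t at hr hl ⊢
  obtain ⟨p, L⟩ := t
  change g.right = Multiplicative.ofAdd (-p) at hr
  change ∀ q, coord g.left (Multiplicative.ofAdd q) = Multiplicative.ofAdd (flow L q) at hl
  have h0 : g.right = 1 ↔ p = 0 := by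
    rw [hr, ofAdd_eq_one, neg_eq_zero]
  have hleft : g.left = 1 ↔ ∀ e ∈ L, flow L e.1 = 0 := by
    constructor
    · intro h e _
      have := hl e.1
      rw [h, coord_one] at this
      exact (ofAdd_eq_one.mp this.symm)
    · intro h
      apply base_ext
      intro q
      have := hl q.toAdd
      rw [ofAdd_toAdd] at this
      rw [this, coord_one, ofAdd_eq_one]
      by_contra h'
      obtain ⟨e, he, rfl⟩ := exists_mem_of_flow_ne_zero h'
      exact h' (h e he)
  have hpos : BasePositive lexLE lexLE g.left ↔ ∃ e ∈ L,
      Multiplicative.ofAdd (flow L e.1) ∈ positiveCone (lexLE (n := n)) ∧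
        ∀ e' ∈ L, flow L e'.1 = 0 ∨
          lexLE (Multiplicative.ofAdd e'.1) (Multiplicative.ofAdd e.1) := by
    constructor
    · rintro ⟨q, hq, hmax⟩
      rw [← ofAdd_toAdd q, hl] at hq
      have : flow L q.toAdd ≠ 0 := fun h => by
        rw [h] at hq
        exact one_notMem_positiveCone hq
      obtain ⟨e, he, heq⟩ := exists_mem_of_flow_ne_zero this
      refine ⟨e, he, by rwa [heq], fun e' _ => ?_⟩
      rw [or_iff_not_imp_left, heq]
      intro h'
      exact hmax _ (by rwa [hl, Ne, ofAdd_eq_one])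
    · rintro ⟨e, -, hpos, hmax⟩
      refine ⟨Multiplicative.ofAdd e.1, by rwa [hl], fun q hq => ?_⟩
      rw [← ofAdd_toAdd q, hl, Ne, ofAdd_eq_one] at hq
      obtain ⟨e', he', heq⟩ := exists_mem_of_flow_ne_zero hq
      rcases hmax e' he' with h | h
      · rw [heq] at h
        exact absurd h hq
      · rwa [heq] at h
  have hone : (1 : Wreath (FreeAb n) (FreeAb n)) = g ↔ g.right = 1 ∧ g.left = 1 := by
    rw [eq_comm, SemidirectProduct.ext_iff]
    exact and_comm
  rw [hone, lexCone, Set.mem_ofPred_eq, TraceNonneg, hleft, hpos, h0, hr]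
  tauto

end Trace

/-! ### Computability for every generating family -/

section Computable

variable {n k : ℕ}

theorem primrec_invWord : Primrec (invWord (k := k)) :=
  Primrec.list_reverse.comp
    (Primrec.list_map (g := fun (_ : Word k) (l : Fin k × Bool) => (l.1, !l.2)) Primrec.id
      ((Primrec.dom_finite fun l : Fin k × Bool => (l.1, !l.2)).comp Primrec.snd))

theorem magnusOrder_iff (u v : FreeMetabelian n) : magnusOrder u v ↔ magnusOrder 1 (u⁻¹ * v) := by
  rw [magnusOrder, lexOrder_one_iff, magnusOrder]
  simp

theorem magnusOrder_isComputableFor (s : Fin k → FreeMetabelian n) :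
    IsComputableFor s magnusOrder := by
  obtain ⟨f, hf⟩ := (FreeMetabelian.generates_gen n).exists_substitution s
  have hsub : Primrec fun w : Word k => w.flatMap f :=
    Primrec.list_flatMap Primrec.id ((Primrec.dom_finite f).comp Primrec.snd)
  refine ((primrecPred_traceNonneg.comp (primrec_trace.comp (Primrec.list_append.comp
    (primrec_invWord.comp (hsub.comp Primrec.fst)) (hsub.comp Primrec.snd)))).of_eq
    fun p => ?_).computablePred
  rw [← magnusOrder_one_iff, eval_append, eval_invWord, ← hf, ← hf, ← magnusOrder_iff]

theorem FreeMetabelian.fg (n : ℕ) : Group.FG (FreeMetabelian n) := inferInstance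

theorem magnusOrder_isComputableOrder : IsComputableOrder (magnusOrder (n := n)) :=
  ⟨FreeMetabelian.fg n, fun _ s _ => magnusOrder_isComputableFor s⟩

end Computable

/-! ### Context-free grammars over a group -/

section ContextFree

variable {G : Type*} [Group G] {N : Type}

/-- Rules of a grammar whose nonterminal symbols stand for subsets of a group. -/
inductive GroupRule (N G : Type*)
  | term (A : N) (u : G)
  | lin (A : N) (u : G) (B : N) (v : G)
  | bin (A B C : N)

/-- A family of subsets of a group is closed under a rule. -/
def GroupRule.Holds (S : N → Set G) : GroupRule N G → Prop
  | term A u => u ∈ S A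
  | lin A u B v => ∀ g ∈ S B, u * g * v ∈ S A
  | bin A B C => ∀ g ∈ S B, ∀ h ∈ S C, g * h ∈ S A

/-- The context-free rule obtained by spelling the group elements in a rule. -/
def GroupRule.spell {T : Type*} (word : G → List T) : GroupRule N G → ContextFreeRule T N
  | term A u => ⟨A, (word u).map .terminal⟩
  | lin A u B v => ⟨A, (word u).map .terminal ++ [.nonterminal B] ++ (word v).map .terminal⟩
  | bin A B C => ⟨A, [.nonterminal B] ++ [.nonterminal C]⟩

open scoped Pointwise in
/-- The subset of the group described by a string of letters and nonterminal symbols. -/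
def stringValue {k : ℕ} (s : Fin k → G) (S : N → Set G)
    (u : List (Symbol (Fin k × Bool) N)) : Set G :=
  (u.map fun
    | .terminal l => {eval s [l]}
    | .nonterminal A => S A).prod

section

variable {k : ℕ} (s : Fin k → G) (S : N → Set G)

open scoped Pointwise in
theorem stringValue_append (u v : List (Symbol (Fin k × Bool) N)) :
    stringValue s S (u ++ v) = stringValue s S u * stringValue s S v := by
  simp [stringValue]

open scoped Pointwise in
theorem stringValue_nonterminal (A : N) : stringValue s S [.nonterminal A] = S A := by
  rw [stringValue, List.map_singleton, List.prod_singleton]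

theorem stringValue_word (w : Word k) :
    stringValue s S (w.map .terminal) = {eval s w} := by
  induction w with
  | nil => rfl
  | cons l w ih =>
    rw [List.map_cons, ← List.singleton_append, stringValue_append, ih, eval_cons]
    simp [stringValue]

open scoped Pointwise in
theorem GroupRule.Holds.stringValue_subset {s S} {word : G → Word k}
    (hword : ∀ g, eval s (word g) = g) {r : GroupRule N G} (hr : r.Holds S) :
    stringValue s S (r.spell word).output ⊆ S (r.spell word).input := by
  cases r with
  | term A u =>
    rw [spell, stringValue_word, hword]
    exact Set.singleton_subset_iff.mpr hr
  | lin A u B v =>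
    rw [spell, stringValue_append, stringValue_append, stringValue_word, stringValue_word,
      stringValue_nonterminal, hword, hword]
    rintro _ ⟨_, ⟨_, rfl, g, hg, rfl⟩, _, rfl, rfl⟩
    exact hr g hg
  | bin A B C =>
    rw [spell, stringValue_append, stringValue_nonterminal, stringValue_nonterminal]
    rintro _ ⟨g, hg, h, hh, rfl⟩
    exact hr g hg h hh

end

/-- The least family of subsets of a group which is closed under the given rules. -/
def leastSolution (rules : List (GroupRule N G)) (A : N) : Set G :=
  {g | ∀ S : N → Set G, (∀ r ∈ rules, r.Holds S) → g ∈ S A}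

theorem leastSolution_subset {rules : List (GroupRule N G)} {S : N → Set G}
    (hS : ∀ r ∈ rules, r.Holds S) (A : N) : leastSolution rules A ⊆ S A := fun _ hg => hg S hS

/-- Every rule is monotone in its premises, so the intersection of all closed families is closed. -/
theorem holds_leastSolution (rules : List (GroupRule N G)) :
    ∀ r ∈ rules, r.Holds (leastSolution rules) := by
  intro r hr
  cases r with
  | term A u => exact fun S hS => hS _ hr
  | lin A u B v => exact fun g hg S hS => hS _ hr g (hg S hS)
  | bin A B C => exact fun g hg h hh S hS => hS _ hr g (hg S hS) h (hh S hS)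

/-- The least solution of a finite system of rules consists of images of context-free
languages. -/
theorem exists_isContextFree_leastSolution {k : ℕ} {s : Fin k → G} (hs : Generates s)
    (rules : List (GroupRule N G)) (A₀ : N) :
    ∃ L : Language (Fin k × Bool), L.IsContextFree ∧
      eval s '' {w | w ∈ L} = leastSolution rules A₀ := by
  classical
  choose word hword using hs.exists_word
  let g : ContextFreeGrammar (Fin k × Bool) :=
    { NT := N
      initial := A₀
      rules := (rules.map (GroupRule.spell word)).toFinset }
  have hstep : ∀ r ∈ rules, g.Derives [.nonterminal (r.spell word).input]
      (r.spell word).output := fun r hr =>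
    ContextFreeGrammar.Produces.single ⟨r.spell word,
      List.mem_toFinset.mpr (List.mem_map_of_mem hr), ContextFreeRule.Rewrites.input_output⟩
  refine ⟨g.language, ⟨g, rfl⟩, Set.Subset.antisymm ?_ ?_⟩
  · rintro _ ⟨w, hw, rfl⟩
    intro S hS
    -- Soundness: for a closed family, a production step can only shrink the subset described by a
    -- string.
    have key : ∀ u v : List (Symbol (Fin k × Bool) N), g.Derives u v →
        stringValue s S v ⊆ stringValue s S u := by
      intro u v huv
      induction huv with
      | refl => exact subset_rfl
      | tail _ hbc ih =>
        refine subset_trans ?_ ih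
        obtain ⟨r, hr, hrw⟩ := hbc
        obtain ⟨r', hr', rfl⟩ := List.mem_map.mp (List.mem_toFinset.mp hr)
        obtain ⟨p, q, rfl, rfl⟩ := hrw.exists_parts
        simp only [stringValue_append, stringValue_nonterminal]
        exact Set.mul_subset_mul_right (Set.mul_subset_mul_left
          ((hS r' hr').stringValue_subset hword))
    have := key _ _ hw
    rw [stringValue_word] at this
    erw [stringValue_nonterminal] at this
    simpa using this
  -- Completeness: the values of the words derivable from each nonterminal form a closed family.
  · refine leastSolution_subset (S := fun A =>
      eval s '' {w | g.Derives [.nonterminal A] (w.map .terminal)})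
      (fun r hr => ?_) A₀
    have h := hstep r hr
    cases r with
    | term A u => exact ⟨word u, h, hword u⟩
    | lin A u B v =>
      rintro _ ⟨w, hw, rfl⟩
      refine ⟨word u ++ w ++ word v, h.trans ?_, by simp [hword, mul_assoc]⟩
      rw [List.map_append, List.map_append]
      exact (hw.append_left _).append_right _
    | bin A B C =>
      rintro _ ⟨v, hv, rfl⟩ _ ⟨w, hw, rfl⟩
      refine ⟨v ++ w, h.trans ?_, eval_append s v w⟩
      rw [List.map_append]
      exact (hv.append_right _).trans (hw.append_left _)

end ContextFree

/-! ### Regular languages for the positive powers of an element -/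

section Regular

/-- The automaton which reads repetitions of the word `u`; the state is the rest of the current
copy. -/
def cycleNFA {α : Type*} (u : List α) : NFA α {v // v ∈ u.tails} where
  step v a := {v' | v.1 = a :: v'.1 ∨ (v.1 = [] ∧ u = a :: v'.1)}
  start := {⟨u, by simp⟩}
  accept := {⟨[], by simp⟩}

/-- Tracking one successor state instead of a set of states makes induction on the word possible. -/
theorem cons_mem_acceptsFrom_cycleNFA {α : Type*} {u : List α} {v : {v // v ∈ u.tails}} {a : α}
    {w : List α} : a :: w ∈ (cycleNFA u).acceptsFrom {v} ↔
      ∃ v' : {v // v ∈ u.tails}, (v.1 = a :: v'.1 ∨ (v.1 = [] ∧ u = a :: v'.1)) ∧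
        w ∈ (cycleNFA u).acceptsFrom {v'} := by
  rw [NFA.cons_mem_acceptsFrom, NFA.stepSet_singleton, NFA.mem_acceptsFrom]
  simp only [NFA.mem_acceptsFrom]
  constructor
  · rintro ⟨t, ht, h⟩
    obtain ⟨v', hv', h'⟩ := NFA.mem_evalFrom_iff_exists.mp h
    exact ⟨v', hv', t, ht, h'⟩
  · rintro ⟨v', hv', t, ht, h'⟩
    exact ⟨t, ht, NFA.mem_evalFrom_iff_exists.mpr ⟨v', hv', h'⟩⟩

theorem append_mem_acceptsFrom_cycleNFA {α : Type*} {u : List α} (v : List α)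
    (hv : v ∈ u.tails) {w : List α} (hw : w ∈ (cycleNFA u).acceptsFrom {⟨[], by simp⟩}) :
    v ++ w ∈ (cycleNFA u).acceptsFrom {⟨v, hv⟩} := by
  induction v with
  | nil => exact hw
  | cons a v ih =>
    have hv' : v ∈ u.tails :=
      (List.mem_tails _ _).mpr ((List.suffix_cons a v).trans ((List.mem_tails _ _).mp hv))
    exact cons_mem_acceptsFrom_cycleNFA.mpr ⟨⟨v, hv'⟩, Or.inl rfl, ih hv'⟩

variable {G : Type*} [Group G] {k : ℕ} {s : Fin k → G}

/-- An accepted word finishes the current copy of `u` and then reads whole copies. -/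
theorem eval_of_mem_acceptsFrom_cycleNFA {u w : Word k} {v : {v // v ∈ u.tails}}
    (hw : w ∈ (cycleNFA u).acceptsFrom {v}) : ∃ m : ℕ, eval s w = eval s v.1 * eval s u ^ m := by
  induction w generalizing v with
  | nil =>
    obtain ⟨t, rfl, ht⟩ := (NFA.nil_mem_acceptsFrom _).mp hw
    refine ⟨0, ?_⟩
    rw [Set.mem_singleton_iff.mp ht, pow_zero, mul_one]
  | cons a w ih =>
    obtain ⟨v', hv', h⟩ := cons_mem_acceptsFrom_cycleNFA.mp hw
    obtain ⟨m, hm⟩ := ih h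
    rcases hv' with hv' | ⟨hv', hu⟩
    · exact ⟨m, by rw [hv', eval_cons, hm, eval_cons s a v'.1, mul_assoc]⟩
    · refine ⟨m + 1, ?_⟩
      rw [hv', eval_nil, one_mul, eval_cons, hm, pow_succ']
      have : eval s u = eval s [a] * eval s v'.1 :=
        (congrArg (eval s) hu).trans (eval_cons ..)
      rw [← mul_assoc, ← this]

theorem exists_isRegular_powers (hs : Generates s) (g : G) :
    ∃ L : Language (Fin k × Bool), L.IsRegular ∧
      eval s '' {w | w ∈ L} = {h | ∃ m : ℕ, h = g ^ (m + 1)} := by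
  classical
  obtain ⟨u, rfl⟩ := hs.exists_word g
  have : Fintype {v // v ∈ u.tails} := List.Subtype.fintype _
  refine ⟨(cycleNFA u).accepts, ⟨_, inferInstance, (cycleNFA u).toDFA, NFA.toDFA_correct⟩,
    Set.Subset.antisymm ?_ ?_⟩
  · rintro _ ⟨w, hw, rfl⟩
    obtain ⟨m, hm⟩ := eval_of_mem_acceptsFrom_cycleNFA (s := s) (v := ⟨u, by simp⟩) hw
    exact ⟨m, by rw [hm, pow_succ']⟩
  · rintro _ ⟨m, rfl⟩
    have hu : ∀ w ∈ (cycleNFA u).acceptsFrom {⟨[], by simp⟩},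
        u ++ w ∈ (cycleNFA u).acceptsFrom {⟨[], by simp⟩} := by
      intro w hw
      by_cases hnil : u = []
      · subst hnil
        exact hw
      · obtain ⟨a, v, hu⟩ := List.exists_cons_of_ne_nil hnil
        have hv : v ∈ u.tails := by simp [hu]
        have := cons_mem_acceptsFrom_cycleNFA (v := ⟨[], by simp⟩).mpr
          ⟨⟨v, hv⟩, Or.inr ⟨rfl, hu⟩, append_mem_acceptsFrom_cycleNFA v hv hw⟩
        rwa [← List.cons_append, ← hu] at this
    have hm : ∃ w ∈ (cycleNFA u).acceptsFrom {⟨[], by simp⟩}, eval s w = eval s u ^ m := by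
      induction m with
      | zero => exact ⟨[], (NFA.nil_mem_acceptsFrom _).mpr ⟨_, rfl, rfl⟩, by simp⟩
      | succ m ih =>
        obtain ⟨w, hw, h⟩ := ih
        exact ⟨u ++ w, hu w hw, by rw [eval_append, h, pow_succ']⟩
    obtain ⟨w, hw, h⟩ := hm
    exact ⟨u ++ w, append_mem_acceptsFrom_cycleNFA u (by simp) hw,
      by rw [eval_append, h, pow_succ']⟩

end Regular

/-! ### Regularity of the lexicographic order on `ℤⁿ` -/

section RegularLex

variable {n : ℕ}

/-- The automaton for the lexicographic order on `ℤⁿ`: the initial state, the state in which the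
leading coordinate is `i`, and the failure state. -/
def lexDFA (n : ℕ) : DFA (Fin n × Bool) (Option (Option (Fin n))) where
  step
    | none, _ => none
    | some none, l => if l.2 then some (some l.1) else none
    | some (some i), l => if i < l.1 ∨ (i = l.1 ∧ l.2) then some (some i) else none
  start := some none
  accept := {st | ∃ i, st = some (some i)}

/-- The initial state is never re-entered, so the first letter fixes the leading coordinate `i`.
Later letters may only increase coordinate `i` or change coordinates after it. The first clause
supplies the value of the word on leaving the initial state. -/
theorem lexDFA_eval_spec (w : Word n) :
    ((lexDFA n).eval w = some none → w = []) ∧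
    ∀ i, (lexDFA n).eval w = some (some i) →
      (∀ j < i, (eval FreeAb.basis w).toAdd j = 0) ∧ 0 < (eval FreeAb.basis w).toAdd i := by
  induction w using List.reverseRecOn with
  | nil =>
    refine ⟨fun _ => rfl, fun i h => ?_⟩
    simp [lexDFA, DFA.eval, DFA.evalFrom] at h
  | append_singleton w l ih =>
    rw [DFA.eval_append_singleton, eval_append]
    obtain ⟨j, b⟩ := l
    rcases hst : (lexDFA n).eval w with _ | _ | i
    · simp [lexDFA]
    · rw [ih.1 hst]
      cases b
      · simp [lexDFA]
      · refine ⟨by simp [lexDFA], fun i hi => ?_⟩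
        obtain rfl : j = i := by simpa [lexDFA] using hi
        refine ⟨fun i hi => ?_, ?_⟩
        · simp [eval_singleton, FreeAb.basis, hi.ne]
        · simp [eval_singleton, FreeAb.basis]
    · obtain ⟨h0, hpos⟩ := ih.2 i hst
      by_cases hj : i < j ∨ (i = j ∧ b)
      · have hstep : (lexDFA n).step (some (some i)) (j, b) = some (some i) := if_pos hj
        rw [hstep]
        refine ⟨by simp, fun i' hi' => ?_⟩
        obtain rfl : i = i' := by simpa using hi'
        have hlt : ∀ k < i, (eval FreeAb.basis [(j, b)]).toAdd k = 0 := by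
          intro k hk
          have : k ≠ j := by
            rcases hj with hj | hj
            · exact (hk.trans hj).ne
            · exact hj.1 ▸ hk.ne
          cases b <;> simp [eval_singleton, FreeAb.basis, this]
        have hle : 0 ≤ (eval FreeAb.basis [(j, b)]).toAdd i := by
          rcases hj with hj | ⟨rfl, rfl⟩
          · cases b <;> simp [eval_singleton, FreeAb.basis, hj.ne]
          · simp [eval_singleton, FreeAb.basis]
        refine ⟨fun k hk => ?_, ?_⟩
        · rw [toAdd_mul, Pi.add_apply, h0 k hk, hlt k hk, add_zero]
        · rw [toAdd_mul, Pi.add_apply]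
          exact add_pos_of_pos_of_nonneg hpos hle
      · have hstep : (lexDFA n).step (some (some i)) (j, b) = none := if_neg hj
        simp [hstep]

theorem lexLE_isRegularFor : IsRegularFor (FreeAb.basis (n := n)) lexLE := by
  refine ⟨(lexDFA n).accepts, ⟨_, inferInstance, _, rfl⟩, Set.Subset.antisymm ?_ ?_⟩
  · rintro _ ⟨w, ⟨i, hi⟩, rfl⟩
    exact mem_positiveCone_lexLE.mpr ⟨i, (lexDFA_eval_spec w).2 i hi⟩
  · intro f hf
    obtain ⟨i, hlt, hi⟩ := mem_positiveCone_lexLE.mp hf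
    let R : Set (FreeAb n) := {g | ∃ w, (lexDFA n).eval w = some (some i) ∧
      eval FreeAb.basis w = g}
    -- `R` is closed under appending letters that keep the automaton in state `i`; the element `f`
    -- is assembled inside `R`.
    have hR : ∀ g ∈ R, ∀ l : Fin n × Bool, i < l.1 ∨ (i = l.1 ∧ l.2) →
        g * eval FreeAb.basis [l] ∈ R := by
      rintro _ ⟨w, hw, rfl⟩ l hl
      refine ⟨w ++ [l], ?_, eval_append _ _ _⟩
      rw [DFA.eval_append_singleton, hw]
      exact if_pos hl
    have h0 : ∀ m : ℕ, FreeAb.basis i ^ (m + 1) ∈ R := by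
      intro m
      induction m with
      | zero => exact ⟨[(i, true)], by simp [DFA.eval, lexDFA], by simp [eval_singleton]⟩
      | succ m ih =>
        rw [pow_succ]
        simpa [eval_singleton] using hR _ ih (i, true) (Or.inr ⟨rfl, rfl⟩)
    have hz : ∀ j, i < j → ∀ z : ℤ, ∀ g ∈ R, g * FreeAb.basis j ^ z ∈ R := by
      intro j hj z
      induction z with
      | zero => simp
      | succ m ih =>
        intro g hg
        rw [zpow_add_one, ← mul_assoc]
        simpa [eval_singleton] using hR _ (ih g hg) (j, true) (Or.inl hj)
      | pred m ih =>
        intro g hg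
        rw [zpow_sub_one, ← mul_assoc]
        simpa [eval_singleton] using hR _ (ih g hg) (j, false) (Or.inl hj)
    -- Coordinates after `i` are free to take any exponent, and those before `i` have exponent zero
    -- in `f`.
    have hprod : ∀ t : Finset (Fin n), i ∉ t →
        FreeAb.basis i ^ f.toAdd i * ∏ j ∈ t, FreeAb.basis j ^ f.toAdd j ∈ R := by
      intro t
      induction t using Finset.induction_on with
      | empty =>
        intro _
        obtain ⟨m, hm⟩ : ∃ m : ℕ, f.toAdd i = (m + 1 : ℕ) :=
          ⟨(f.toAdd i).toNat - 1, by omega⟩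
        rw [Finset.prod_empty, mul_one, hm, zpow_natCast]
        exact h0 m
      | insert j t hj ih =>
        intro hit
        rw [Finset.mem_insert, not_or] at hit
        rw [Finset.prod_insert hj, mul_left_comm, mul_comm]
        rcases lt_or_gt_of_ne hit.1 with h | h
        · exact hz j h _ _ (ih hit.2)
        · rw [hlt j h, zpow_zero, mul_one]
          exact ih hit.2
    have := hprod (Finset.univ.erase i) (Finset.notMem_erase _ _)
    rw [Finset.mul_prod_erase _ (fun j => FreeAb.basis j ^ f.toAdd j) (Finset.mem_univ i),
      FreeAb.prod_basis_zpow] at this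
    obtain ⟨w, hw, rfl⟩ := this
    exact ⟨w, ⟨i, hw⟩, rfl⟩

end RegularLex

/-! ### Rank one -/

section RankOne

/-- The exponent map on the free metabelian group of rank one. -/
def rankOneHom : FreeMetabelian 1 →* Multiplicative ℤ :=
  QuotientGroup.lift _ (FreeGroup.lift fun _ => Multiplicative.ofAdd 1) fun _ hw =>
    Abelianization.commutator_subset_ker _
      (derivedSeries_one (FreeGroup (Fin 1)) ▸ derivedSeries_antitone _ one_le_two hw)

theorem rankOneHom_gen (i : Fin 1) :
    rankOneHom (FreeMetabelian.gen i) = Multiplicative.ofAdd 1 :=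
  FreeGroup.lift_apply_of ..

theorem FreeMetabelian.exists_zpow (g : FreeMetabelian 1) :
    ∃ z : ℤ, FreeMetabelian.gen 0 ^ z = g := by
  have h : g ∈ Subgroup.closure (Set.range FreeMetabelian.gen) := by
    rw [show Subgroup.closure (Set.range FreeMetabelian.gen) = ⊤ from
      FreeMetabelian.generates_gen 1]
    trivial
  rwa [Set.range_unique, ← Subgroup.zpowers_eq_closure] at h

theorem rankOneHom_gen_zpow (z : ℤ) :
    rankOneHom (FreeMetabelian.gen 0 ^ z) = Multiplicative.ofAdd z := by
  rw [map_zpow, rankOneHom_gen, ← ofAdd_zsmul]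
  simp

theorem rankOneHom_bijective : Function.Bijective rankOneHom := by
  constructor
  · intro g h hgh
    obtain ⟨y, rfl⟩ := FreeMetabelian.exists_zpow g
    obtain ⟨z, rfl⟩ := FreeMetabelian.exists_zpow h
    rw [rankOneHom_gen_zpow, rankOneHom_gen_zpow] at hgh
    rw [Multiplicative.ofAdd.injective hgh]
  · exact fun z => ⟨FreeMetabelian.gen 0 ^ z.toAdd, rankOneHom_gen_zpow _⟩

theorem le_isBiOrder_int : IsBiOrder fun y z : Multiplicative ℤ => y ≤ z where
  isLinearOrder :=
    { refl := le_refl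
      trans := fun _ _ _ => le_trans
      antisymm := fun _ _ => le_antisymm
      total := le_total }
  mul_le_mul _ _ _ _ h := mul_le_mul_left (mul_le_mul_right h _) _

/-- The standard order on the infinite cyclic group `M_1`. -/
def rankOneOrder (g h : FreeMetabelian 1) : Prop := rankOneHom g ≤ rankOneHom h

theorem rankOneOrder_isBiOrder : IsBiOrder rankOneOrder :=
  le_isBiOrder_int.comap rankOneHom rankOneHom_bijective.1

theorem rankOneOrder_isRegularOrder : IsRegularOrder rankOneOrder := by
  refine ⟨FreeMetabelian.fg 1, fun k s hs => ?_⟩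
  obtain ⟨L, hL, h⟩ := exists_isRegular_powers hs (FreeMetabelian.gen 0 : FreeMetabelian 1)
  refine ⟨L, hL, h.trans ?_⟩
  ext g
  obtain ⟨z, rfl⟩ := FreeMetabelian.exists_zpow g
  have : (FreeMetabelian.gen 0 : FreeMetabelian 1) ^ z ∈ positiveCone rankOneOrder ↔ 0 < z := by
    have h1 : rankOneOrder 1 (FreeMetabelian.gen 0 ^ z) ↔ 0 ≤ z := by
      rw [rankOneOrder, map_one, rankOneHom_gen_zpow]
      exact Iff.rfl
    have h2 : (1 : FreeMetabelian 1) ≠ FreeMetabelian.gen 0 ^ z ↔ 0 ≠ z := by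
      rw [← rankOneHom_bijective.1.ne_iff, map_one, rankOneHom_gen_zpow]
      exact Iff.rfl
    rw [lt_iff_le_and_ne, ← h1, ← h2]
    exact Iff.rfl
  rw [this]
  constructor
  · rintro ⟨m, hm⟩
    rw [← rankOneHom_bijective.1.eq_iff, ← zpow_natCast, rankOneHom_gen_zpow,
      rankOneHom_gen_zpow] at hm
    have := Multiplicative.ofAdd.injective hm
    omega
  · intro hz
    refine ⟨z.toNat - 1, ?_⟩
    rw [← zpow_natCast]
    congr 1
    omega

end RankOne

/-! ### Loops and their leading coordinates -/

section Edges

variable {n : ℕ}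

/-- The image of an element of the free metabelian group in `ℤⁿ`. -/
noncomputable def exponents (n : ℕ) : FreeMetabelian n →* FreeAb n :=
  SemidirectProduct.rightHom.comp (magnus n)

/-- The coordinates of the base component of the Magnus image. -/
noncomputable def edge (g : FreeMetabelian n) (q : FreeAb n) : FreeAb n :=
  coord (magnus n g).left q

@[simp] theorem exponents_gen (i : Fin n) :
    exponents n (FreeMetabelian.gen i) = FreeAb.basis i := by
  change (magnus n (FreeMetabelian.gen i)).right = _
  simp [magnus_isMagnus i, Wreath.ofA, Wreath.ofT]

theorem edge_one (q : FreeAb n) : edge 1 q = 1 := by simp [edge]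

theorem edge_mul {g : FreeMetabelian n} (hg : exponents n g = 1) (h : FreeMetabelian n)
    (q : FreeAb n) : edge (g * h) q = edge g q * edge h q := by
  replace hg : (magnus n g).right = 1 := hg
  simp [edge, hg]

theorem edge_inv {g : FreeMetabelian n} (hg : exponents n g = 1) (q : FreeAb n) :
    edge g⁻¹ q = (edge g q)⁻¹ := by
  rw [eq_inv_iff_mul_eq_one, ← edge_mul (by rw [map_inv, hg, inv_one]), inv_mul_cancel, edge_one]

theorem edge_conj (t : FreeMetabelian n) {g : FreeMetabelian n} (hg : exponents n g = 1)
    (q : FreeAb n) : edge (t * g * t⁻¹) q = edge g (q * exponents n t) := by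
  replace hg : (magnus n g).right = 1 := hg
  change _ = edge g (q * (magnus n t).right)
  simp [edge, hg]

theorem mul_comm_of_exponents {g h : FreeMetabelian n} (hg : exponents n g = 1)
    (hh : exponents n h = 1) : g * h = h * g := by
  apply magnus_injective
  replace hg : (magnus n g).right = 1 := hg
  replace hh : (magnus n h).right = 1 := hh
  rw [map_mul, map_mul]
  ext1
  · simp [hg, hh, mul_comm]
  · simp [hg, hh]

theorem exponents_conj (t g : FreeMetabelian n) :
    exponents n (t * g * t⁻¹) = exponents n g := by simp

/-- The subgroup of all loops supported in a given set of coordinates. -/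
noncomputable def loopsIn (U : FreeAb n → Prop) : Subgroup (FreeMetabelian n) where
  carrier := {g | exponents n g = 1 ∧ ∀ q, edge g q ≠ 1 → U q}
  one_mem' := ⟨map_one _, fun q h => absurd (edge_one q) h⟩
  mul_mem' := by
    rintro g h ⟨hg, hg'⟩ ⟨hh, hh'⟩
    refine ⟨by rw [map_mul, hg, hh, one_mul], fun q hq => ?_⟩
    by_cases h1 : edge g q = 1
    · exact hh' q fun h2 => hq (by rw [edge_mul hg, h1, h2, one_mul])
    · exact hg' q h1
  inv_mem' := by
    rintro g ⟨hg, hg'⟩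
    refine ⟨by rw [map_inv, hg, inv_one], fun q hq => hg' q fun h => hq ?_⟩
    rw [edge_inv hg, h, inv_one]

theorem loopsIn_mono {U U' : FreeAb n → Prop} (h : ∀ q, U q → U' q) : loopsIn U ≤ loopsIn U' :=
  fun _ hg => ⟨hg.1, fun q hq => h q (hg.2 q hq)⟩

theorem conj_mem_loopsIn {U U' : FreeAb n → Prop} (t : FreeMetabelian n)
    (h : ∀ q, U (q * exponents n t) → U' q) {g : FreeMetabelian n} (hg : g ∈ loopsIn U) :
    t * g * t⁻¹ ∈ loopsIn U' := by
  refine ⟨by rw [exponents_conj, hg.1], fun q hq => h q (hg.2 _ ?_)⟩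
  rwa [edge_conj t hg.1] at hq

/-- The set of all loops whose leading coordinate is at `p` and is positive. -/
def loopsLeading (p : FreeAb n) : Set (FreeMetabelian n) :=
  {g | g ∈ loopsIn (fun q => lexLE q p) ∧ edge g p ∈ positiveCone (lexLE (n := n))}

theorem mul_mem_loopsLeading {p : FreeAb n} {g h : FreeMetabelian n} (hg : g ∈ loopsLeading p)
    (hh : h ∈ loopsLeading p) : g * h ∈ loopsLeading p :=
  ⟨mul_mem hg.1 hh.1, by
    rw [edge_mul hg.1.1]
    exact lexLE_isBiOrder.mul_mem hg.2 hh.2⟩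

/-- A factor living below `p` and missing `p` does not affect the leading coefficient. -/
theorem mul_mem_loopsLeading_of_loopsIn {p : FreeAb n} {U : FreeAb n → Prop}
    (hU : ∀ q, U q → lexLE q p) (hU' : ¬ U p) {g h : FreeMetabelian n}
    (hg : g ∈ loopsLeading p) (hh : h ∈ loopsIn U) : g * h ∈ loopsLeading p := by
  refine ⟨mul_mem hg.1 (loopsIn_mono hU hh), ?_⟩
  have : edge h p = 1 := by
    by_contra h'
    exact hU' (hh.2 p h')
  rw [edge_mul hg.1.1, this, mul_one]
  exact hg.2

theorem conj_mem_loopsLeading (t : FreeMetabelian n) {p : FreeAb n} {g : FreeMetabelian n}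
    (hg : g ∈ loopsLeading p) : t * g * t⁻¹ ∈ loopsLeading (p * (exponents n t)⁻¹) := by
  refine ⟨conj_mem_loopsIn t (fun q hq => ?_) hg.1, ?_⟩
  · simpa using lexLE_isBiOrder.mul_right (exponents n t)⁻¹ hq
  · rw [edge_conj t hg.1.1, inv_mul_cancel_right]
    exact hg.2

theorem mem_positiveCone_magnusOrder {g : FreeMetabelian n} :
    g ∈ positiveCone (magnusOrder (n := n)) ↔
      exponents n g ∈ positiveCone (lexLE (n := n)) ∨ ∃ p, g ∈ loopsLeading p := by
  have h1 : g ∈ positiveCone (magnusOrder (n := n)) ↔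
      magnus n g ∈ positiveCone (lexOrder (lexLE (n := n)) lexLE) := by
    have h2 : (1 : FreeMetabelian n) ≠ g ↔ 1 ≠ magnus n g := by
      rw [← map_one (magnus n), magnus_injective.ne_iff]
    change (lexOrder _ _ (magnus n 1) _ ∧ _) ↔ (_ ∧ _)
    rw [map_one, h2]
  rw [h1, positiveCone_lexOrder]
  refine or_congr Iff.rfl ⟨?_, ?_⟩
  · rintro ⟨h, p, hp, hmax⟩
    exact ⟨p, ⟨h, hmax⟩, hp⟩
  · rintro ⟨p, ⟨h, hmax⟩, hp⟩
    exact ⟨h, p, hp, hmax⟩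

end Edges

/-! ### The grammar in rank two and its soundness -/

section RankTwo

theorem lexLE_two_iff {f g : FreeAb 2} : lexLE f g ↔
    f.toAdd 0 < g.toAdd 0 ∨ (f.toAdd 0 = g.toAdd 0 ∧ f.toAdd 1 ≤ g.toAdd 1) := by
  rw [lexLE_iff, ← Multiplicative.toAdd.injective.eq_iff, funext_iff]
  simp only [Fin.forall_fin_two, Fin.exists_fin_two, Fin.isValue, not_lt_zero,
    IsEmpty.forall_iff, true_and, lt_self_iff_false, and_true, Fin.zero_lt_one, true_implies]
  omega

theorem mem_positiveCone_two_iff {f : FreeAb 2} : f ∈ positiveCone (lexLE (n := 2)) ↔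
    0 < f.toAdd 0 ∨ (f.toAdd 0 = 0 ∧ 0 < f.toAdd 1) := by
  rw [mem_positiveCone_lexLE]
  simp only [Fin.forall_fin_two, Fin.exists_fin_two, Fin.isValue, not_lt_zero,
    IsEmpty.forall_iff, true_and, lt_self_iff_false, and_true, Fin.zero_lt_one, true_implies]

/-- The first generator of the free metabelian group of rank two. -/
def genX : FreeMetabelian 2 := FreeMetabelian.gen 0

/-- The second generator of the free metabelian group of rank two. -/
def genY : FreeMetabelian 2 := FreeMetabelian.gen 1

/-- The commutator of the two generators. -/
def genC : FreeMetabelian 2 := genX * genY * genX⁻¹ * genY⁻¹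

theorem exponents_genX : exponents 2 genX = FreeAb.basis 0 := exponents_gen 0

theorem exponents_genY : exponents 2 genY = FreeAb.basis 1 := exponents_gen 1

theorem exponents_genC : exponents 2 genC = 1 := by
  simp [genC, mul_comm (exponents 2 genX)]

theorem eval_genC :
    genC = eval FreeMetabelian.gen [(0, true), (1, true), (0, false), (1, false)] := by
  simp [eval, genC, genX, genY, mul_assoc]

theorem edge_genC (q : Fin 2 → ℤ) : edge genC (Multiplicative.ofAdd q) =
    Multiplicative.ofAdd
      (flow (trace [((0 : Fin 2), true), (1, true), (0, false), (1, false)]).2 q) := by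
  rw [edge, eval_genC, coord_magnus_eval_left]

/-- The unit square has its greatest corner at the origin, where the coefficient is `(1, -1)`: one
crossing by the initial `x`, one by the final `y⁻¹`. Its other corners carrying edges are `(-1, 0)`
and `(0, -1)`. -/
theorem genC_mem_loopsLeading : genC ∈ loopsLeading (1 : FreeAb 2) := by
  refine ⟨⟨exponents_genC, fun q hq => ?_⟩, ?_⟩
  · rw [← ofAdd_toAdd q, edge_genC, Ne, ofAdd_eq_one] at hq
    obtain ⟨e, he, heq⟩ := exists_mem_of_flow_ne_zero hq
    rw [lexLE_two_iff, ← heq]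
    have key : ∀ e ∈ (trace [((0 : Fin 2), true), (1, true), (0, false), (1, false)]).2,
        e.1 0 < 0 ∨ (e.1 0 = 0 ∧ e.1 1 ≤ 0) := by decide
    exact key e he
  · rw [← ofAdd_zero, edge_genC, mem_positiveCone_two_iff]
    left
    change 0 < flow (trace [((0 : Fin 2), true), (1, true), (0, false), (1, false)]).2 0 0
    decide

/-- The nonterminal symbols of the grammar for the positive cone. -/
inductive Nonterminal
  | start | positiveLoop | leading | lowerColumn | upperColumn | lowerColumns | columns
  | loops | powerY | positivePowerY | positivePowerX | positiveX

open GroupRule Nonterminal in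
/-- The rules of the grammar for the positive cone of the free metabelian group of rank two. -/
def positiveConeRules : List (GroupRule Nonterminal (FreeMetabelian 2)) := [
  term upperColumn 1, term upperColumn genC, term upperColumn genC⁻¹,
  bin upperColumn upperColumn upperColumn, lin upperColumn genY upperColumn genY⁻¹,
  lin lowerColumn genY upperColumn genY⁻¹,
  term leading genC, lin leading genC leading 1, bin leading leading lowerColumn,
  term columns 1, term columns genC, term columns genC⁻¹, bin columns columns columns,
  lin columns genY columns genY⁻¹, lin columns genY⁻¹ columns genY,
  lin columns genX columns genX⁻¹, lin lowerColumns genX columns genX⁻¹,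
  bin positiveLoop leading lowerColumns,
  lin positiveLoop genX positiveLoop genX⁻¹, lin positiveLoop genX⁻¹ positiveLoop genX,
  lin positiveLoop genY positiveLoop genY⁻¹, lin positiveLoop genY⁻¹ positiveLoop genY,
  term loops 1, term loops genC, term loops genC⁻¹, bin loops loops loops,
  lin loops genX loops genX⁻¹, lin loops genX⁻¹ loops genX,
  lin loops genY loops genY⁻¹, lin loops genY⁻¹ loops genY,
  term powerY 1, lin powerY genY powerY 1, lin powerY genY⁻¹ powerY 1,
  term positivePowerY genY, lin positivePowerY genY positivePowerY 1,
  term positivePowerX genX, lin positivePowerX genX positivePowerX 1,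
  bin positiveX powerY positivePowerX,
  lin start 1 positiveLoop 1, bin start loops positivePowerY, bin start loops positiveX]

/-- A family of subsets which is closed under the rules of the grammar. -/
def coneSolution : Nonterminal → Set (FreeMetabelian 2)
  | .start => positiveCone magnusOrder
  | .positiveLoop => {g | ∃ p, g ∈ loopsLeading p}
  | .leading => loopsLeading 1
  | .lowerColumn => (loopsIn (n := 2) fun q => q.toAdd 0 < 0 ∨ (q.toAdd 0 = 0 ∧ q.toAdd 1 < 0) : Subgroup _)
  | .upperColumn => (loopsIn (n := 2) fun q => q.toAdd 0 < 0 ∨ (q.toAdd 0 = 0 ∧ q.toAdd 1 ≤ 0) : Subgroup _)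
  | .lowerColumns => (loopsIn (n := 2) fun q => q.toAdd 0 < 0 : Subgroup _)
  | .columns => (loopsIn (n := 2) fun q => q.toAdd 0 ≤ 0 : Subgroup _)
  | .loops => {g | exponents 2 g = 1}
  | .powerY => {g | (exponents 2 g).toAdd 0 = 0}
  | .positivePowerY => {g | (exponents 2 g).toAdd 0 = 0 ∧ 0 < (exponents 2 g).toAdd 1}
  | .positivePowerX => {g | 0 < (exponents 2 g).toAdd 0}
  | .positiveX => {g | 0 < (exponents 2 g).toAdd 0}

theorem conj_inv_mem_loopsIn {U U' : FreeAb 2 → Prop} (t : FreeMetabelian 2)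
    (h : ∀ q, U (q * (exponents 2 t)⁻¹) → U' q) {g : FreeMetabelian 2} (hg : g ∈ loopsIn U) :
    t⁻¹ * g * t ∈ loopsIn U' := by
  have := conj_mem_loopsIn (U' := U') t⁻¹ (by rwa [map_inv]) hg
  rwa [inv_inv] at this

theorem conj_inv_mem_loopsLeading (t : FreeMetabelian 2) {p : FreeAb 2} {g : FreeMetabelian 2}
    (hg : g ∈ loopsLeading p) : t⁻¹ * g * t ∈ loopsLeading (p * exponents 2 t) := by
  have := conj_mem_loopsLeading t⁻¹ hg
  rwa [map_inv, inv_inv, inv_inv] at this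

theorem genC_mem_loopsIn : genC ∈ loopsIn (n := 2)
    fun q => q.toAdd 0 < 0 ∨ (q.toAdd 0 = 0 ∧ q.toAdd 1 ≤ 0) :=
  loopsIn_mono (fun _ hq => lexLE_two_iff.mp hq) genC_mem_loopsLeading.1

theorem genC_mem_columns : genC ∈ loopsIn (n := 2) fun q => q.toAdd 0 ≤ 0 :=
  loopsIn_mono (fun _ _ => by omega) genC_mem_loopsIn

theorem basis_zero_apply : (FreeAb.basis (0 : Fin 2)).toAdd 0 = 1 ∧
    (FreeAb.basis (0 : Fin 2)).toAdd 1 = 0 := by simp [FreeAb.basis]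

theorem basis_one_apply : (FreeAb.basis (1 : Fin 2)).toAdd 0 = 0 ∧
    (FreeAb.basis (1 : Fin 2)).toAdd 1 = 1 := by simp [FreeAb.basis]

/-- This is soundness of the grammar. Several of the sets are deliberately generous: they retain
only the information about supports and exponents that the rules for `start` need. -/
theorem holds_coneSolution : ∀ r ∈ positiveConeRules, r.Holds coneSolution := by
  obtain ⟨h00, -⟩ := basis_zero_apply
  obtain ⟨h10, h11⟩ := basis_one_apply
  simp only [positiveConeRules, List.forall_mem_cons, List.not_mem_nil, IsEmpty.forall_iff,
    implies_true, and_true]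
  refine ⟨?_, ?_, ?_, ?_, ?_, ?_, ?_, ?_, ?_, ?_, ?_, ?_, ?_, ?_, ?_, ?_, ?_, ?_, ?_, ?_, ?_, ?_,
    ?_, ?_, ?_, ?_, ?_, ?_, ?_, ?_, ?_, ?_, ?_, ?_, ?_, ?_, ?_, ?_, ?_, ?_, ?_⟩
  · exact one_mem (loopsIn _)
  · exact genC_mem_loopsIn
  · exact inv_mem genC_mem_loopsIn
  · exact fun g hg h hh => mul_mem (S := Subgroup _) hg hh
  · refine fun g hg => conj_mem_loopsIn genY (fun q hq => ?_) hg
    simp only [exponents_genY, toAdd_mul, Pi.add_apply, h10, h11] at hq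
    omega
  · refine fun g hg => conj_mem_loopsIn genY (fun q hq => ?_) hg
    simp only [exponents_genY, toAdd_mul, Pi.add_apply, h10, h11] at hq
    omega
  · exact genC_mem_loopsLeading
  · intro g hg
    rw [mul_one]
    exact mul_mem_loopsLeading genC_mem_loopsLeading hg
  · refine fun g hg h hh => mul_mem_loopsLeading_of_loopsIn (fun q hq => ?_) ?_ hg hh
    · rw [lexLE_two_iff]
      change q.toAdd 0 < 0 ∨ (q.toAdd 0 = 0 ∧ q.toAdd 1 ≤ 0)
      omega
    · simp
  · exact one_mem (loopsIn _)
  · exact genC_mem_columns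
  · exact inv_mem genC_mem_columns
  · exact fun g hg h hh => mul_mem (S := Subgroup _) hg hh
  · refine fun g hg => conj_mem_loopsIn genY (fun q hq => ?_) hg
    simp only [exponents_genY, toAdd_mul, Pi.add_apply, h10] at hq
    omega
  · refine fun g hg => conj_inv_mem_loopsIn genY (fun q hq => ?_) hg
    simp only [exponents_genY, toAdd_mul, toAdd_inv, Pi.add_apply, Pi.neg_apply, h10] at hq
    omega
  · refine fun g hg => conj_mem_loopsIn genX (fun q hq => ?_) hg
    simp only [exponents_genX, toAdd_mul, Pi.add_apply, h00] at hq
    omega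
  · refine fun g hg => conj_mem_loopsIn genX (fun q hq => ?_) hg
    simp only [exponents_genX, toAdd_mul, Pi.add_apply, h00] at hq
    omega
  · intro g hg h hh
    refine ⟨1, mul_mem_loopsLeading_of_loopsIn (fun q hq => ?_) ?_ hg hh⟩
    · exact lexLE_two_iff.mpr (Or.inl hq)
    · simp
  · rintro g ⟨p, hg⟩
    exact ⟨_, conj_mem_loopsLeading genX hg⟩
  · rintro g ⟨p, hg⟩
    exact ⟨_, conj_inv_mem_loopsLeading genX hg⟩
  · rintro g ⟨p, hg⟩
    exact ⟨_, conj_mem_loopsLeading genY hg⟩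
  · rintro g ⟨p, hg⟩
    exact ⟨_, conj_inv_mem_loopsLeading genY hg⟩
  · exact map_one _
  · exact exponents_genC
  · exact (map_inv _ _).trans (by rw [exponents_genC, inv_one])
  · intro g hg h hh
    exact (map_mul _ _ _).trans (by rw [show exponents 2 g = 1 from hg, one_mul]; exact hh)
  · exact fun g hg => (exponents_conj genX g).trans hg
  · intro g hg
    have := (exponents_conj genX⁻¹ g).trans hg
    rwa [inv_inv] at this
  · exact fun g hg => (exponents_conj genY g).trans hg
  · intro g hg
    have := (exponents_conj genY⁻¹ g).trans hg
    rwa [inv_inv] at this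
  all_goals simp only [GroupRule.Holds, coneSolution, Set.mem_ofPred_eq, map_mul, map_one, map_inv, mul_one,
    exponents_genX, exponents_genY, toAdd_mul, toAdd_inv, toAdd_one, Pi.add_apply, Pi.neg_apply,
    Pi.zero_apply, h00, h10, h11, one_mul, mem_positiveCone_magnusOrder,
    mem_positiveCone_two_iff]
  · intro g hg; omega
  · intro g hg; omega
  · simp
  · intro g hg; omega
  · omega
  · intro g hg; omega
  · intro g hg h hh; omega
  · exact fun g hg => Or.inr hg
  · intro g hg h hh
    simp only [hg, toAdd_one, Pi.zero_apply]
    omega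
  · intro g hg h hh
    simp only [hg, toAdd_one, Pi.zero_apply]
    omega

end RankTwo

/-! ### Completeness of the grammar -/

section ConeComplete

open GroupRule Nonterminal

/-- The subset of the group described by a nonterminal symbol of the grammar. -/
abbrev coneSet (A : Nonterminal) : Set (FreeMetabelian 2) := leastSolution positiveConeRules A

theorem holds_coneSet (r : GroupRule Nonterminal (FreeMetabelian 2))
    (hr : r ∈ positiveConeRules := by
      simp only [positiveConeRules, List.mem_cons, true_or, or_true]) : r.Holds coneSet := holds_leastSolution _ r hr

/-- The two conjugators differ by a loop, and loops commute. -/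
theorem conj_eq_conj {g h d : FreeMetabelian 2} (hgh : exponents 2 g = exponents 2 h)
    (hd : exponents 2 d = 1) : g * d * g⁻¹ = h * d * h⁻¹ := by
  have hc := mul_comm_of_exponents (g := h⁻¹ * g) (by rw [map_mul, map_inv, hgh, inv_mul_cancel])
    hd
  calc g * d * g⁻¹ = h * (h⁻¹ * g * d) * g⁻¹ := by group
    _ = h * d * h⁻¹ := by rw [hc]; group

/-- The subgroup generated by all conjugates of the commutator of the generators at a given set
of places. -/
def squares (U : FreeAb 2 → Prop) : Subgroup (FreeMetabelian 2) :=
  Subgroup.closure {d | ∃ g, U (exponents 2 g) ∧ d = g * genC * g⁻¹}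

variable {U U' : FreeAb 2 → Prop}

theorem conj_genC_mem_squares {g : FreeMetabelian 2} (hg : U (exponents 2 g)) :
    g * genC * g⁻¹ ∈ squares U := Subgroup.subset_closure ⟨g, hg, rfl⟩

theorem squares_le {H : Subgroup (FreeMetabelian 2)}
    (h : ∀ g, U (exponents 2 g) → g * genC * g⁻¹ ∈ H) : squares U ≤ H := by
  rw [squares, Subgroup.closure_le]
  rintro _ ⟨g, hg, rfl⟩
  exact h g hg

theorem squares_mono (h : ∀ q, U q → U' q) : squares U ≤ squares U' :=
  squares_le fun _ hg => conj_genC_mem_squares (h _ hg)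

theorem exponents_of_mem_squares {d : FreeMetabelian 2} (hd : d ∈ squares U) :
    exponents 2 d = 1 := by
  have : squares U ≤ (exponents 2).ker :=
    squares_le fun g _ => by rw [MonoidHom.mem_ker, exponents_conj, exponents_genC]
  exact this hd

theorem conj_mem_squares (t : FreeMetabelian 2) (h : ∀ q, U q → U' (exponents 2 t * q))
    {d : FreeMetabelian 2} (hd : d ∈ squares U) : t * d * t⁻¹ ∈ squares U' := by
  have : squares U ≤ (squares U').comap (MulAut.conj t).toMonoidHom := by
    refine squares_le fun g hg => ?_
    have h1 : t * (g * genC * g⁻¹) * t⁻¹ = (t * g) * genC * (t * g)⁻¹ := by group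
    change t * (g * genC * g⁻¹) * t⁻¹ ∈ squares U'
    rw [h1]
    exact conj_genC_mem_squares (by rw [map_mul]; exact h _ hg)
  exact this hd

theorem conj_inv_mem_squares (t : FreeMetabelian 2)
    (h : ∀ q, U q → U' ((exponents 2 t)⁻¹ * q)) {d : FreeMetabelian 2} (hd : d ∈ squares U) :
    t⁻¹ * d * t ∈ squares U' := by
  have := conj_mem_squares (U' := U') t⁻¹ (by rwa [map_inv]) hd
  rwa [inv_inv] at this

/-- Since the squares commute, the factors of a product can be sorted by place. -/
theorem exists_mul_of_mem_squares {U₁ U₂ : FreeAb 2 → Prop} (h : ∀ q, U q → U₁ q ∨ U₂ q)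
    {d : FreeMetabelian 2} (hd : d ∈ squares U) :
    ∃ d₁ ∈ squares U₁, ∃ d₂ ∈ squares U₂, d = d₁ * d₂ := by
  induction hd using Subgroup.closure_induction with
  | mem d hd =>
    obtain ⟨g, hg, rfl⟩ := hd
    rcases h _ hg with h | h
    · exact ⟨_, conj_genC_mem_squares h, 1, one_mem _, by rw [mul_one]⟩
    · exact ⟨1, one_mem _, _, conj_genC_mem_squares h, by rw [one_mul]⟩
  | one => exact ⟨1, one_mem _, 1, one_mem _, by rw [one_mul]⟩
  | mul _ _ _ _ hd he =>
    obtain ⟨d₁, h₁, d₂, h₂, rfl⟩ := hd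
    obtain ⟨e₁, k₁, e₂, k₂, rfl⟩ := he
    refine ⟨_, mul_mem h₁ k₁, _, mul_mem h₂ k₂, ?_⟩
    rw [mul_assoc, ← mul_assoc d₂, mul_comm_of_exponents (exponents_of_mem_squares h₂)
      (exponents_of_mem_squares k₁)]
    simp only [mul_assoc]
  | inv _ _ hd =>
    obtain ⟨d₁, h₁, d₂, h₂, rfl⟩ := hd
    refine ⟨_, inv_mem h₁, _, inv_mem h₂, ?_⟩
    rw [mul_comm_of_exponents (exponents_of_mem_squares h₁) (exponents_of_mem_squares h₂),
      mul_inv_rev]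

theorem squares_subset {S : Set (FreeMetabelian 2)} (one : 1 ∈ S)
    (mul : ∀ g ∈ S, ∀ h ∈ S, g * h ∈ S)
    (conj : ∀ g, U (exponents 2 g) → g * genC * g⁻¹ ∈ S ∧ g * genC⁻¹ * g⁻¹ ∈ S)
    {d : FreeMetabelian 2} (hd : d ∈ squares U) : d ∈ S := by
  -- The set `S` is not assumed closed under inverses, so the induction carries an element together
  -- with its inverse.
  suffices h : d ∈ S ∧ d⁻¹ ∈ S from h.1
  induction hd using Subgroup.closure_induction with
  | mem d hd =>
    obtain ⟨g, hg, rfl⟩ := hd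
    have h : (g * genC * g⁻¹)⁻¹ = g * genC⁻¹ * g⁻¹ := by group
    rw [h]
    exact conj g hg
  | one => exact ⟨one, by rwa [inv_one]⟩
  | mul d e _ _ hd he => exact ⟨mul _ hd.1 _ he.1, by rw [mul_inv_rev]; exact mul _ he.2 _ hd.2⟩
  | inv d _ hd => exact ⟨hd.2, by rw [inv_inv]; exact hd.1⟩

theorem conj_pow_mem {S : Set (FreeMetabelian 2)} {u : FreeMetabelian 2}
    (h : ∀ g ∈ S, u * g * u⁻¹ ∈ S) (m : ℕ) : ∀ g ∈ S, u ^ m * g * (u ^ m)⁻¹ ∈ S := by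
  induction m with
  | zero => simp
  | succ m ih =>
    intro g hg
    have : u ^ (m + 1) * g * (u ^ (m + 1))⁻¹ = u * (u ^ m * g * (u ^ m)⁻¹) * u⁻¹ := by
      rw [pow_succ']
      group
    rw [this]
    exact h _ (ih g hg)

theorem conj_zpow_mem {S : Set (FreeMetabelian 2)} {u : FreeMetabelian 2}
    (h : ∀ g ∈ S, u * g * u⁻¹ ∈ S) (h' : ∀ g ∈ S, u⁻¹ * g * u ∈ S) (z : ℤ) :
    ∀ g ∈ S, u ^ z * g * (u ^ z)⁻¹ ∈ S := by
  intro g hg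
  obtain ⟨m, rfl | rfl⟩ := z.eq_nat_or_neg
  · simpa using conj_pow_mem h m g hg
  · simpa using conj_pow_mem (u := u⁻¹) (by simpa using h') m g hg

/-- A word conjugates letter by letter, so the four conjugation rules of the grammar give all
conjugations. -/
theorem conj_mem_of_generators {S : Set (FreeMetabelian 2)}
    (hx : ∀ g ∈ S, genX * g * genX⁻¹ ∈ S) (hx' : ∀ g ∈ S, genX⁻¹ * g * genX ∈ S)
    (hy : ∀ g ∈ S, genY * g * genY⁻¹ ∈ S) (hy' : ∀ g ∈ S, genY⁻¹ * g * genY ∈ S)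
    (t : FreeMetabelian 2) : ∀ g ∈ S, t * g * t⁻¹ ∈ S := by
  obtain ⟨w, rfl⟩ := (FreeMetabelian.generates_gen 2).exists_word t
  induction w with
  | nil => simp
  | cons l w ih =>
    intro g hg
    rw [eval_cons]
    generalize eval FreeMetabelian.gen w = t at ih
    have : ∀ u : FreeMetabelian 2, u * t * g * (u * t)⁻¹ = u * (t * g * t⁻¹) * u⁻¹ := by
      intro u
      group
    rw [this, eval_singleton]
    obtain ⟨i, _ | _⟩ := l <;> fin_cases i
    · simpa [genX] using hx' _ (ih g hg)
    · simpa [genY] using hy' _ (ih g hg)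
    · exact hx _ (ih g hg)
    · exact hy _ (ih g hg)

theorem exponents_zpow_mul_zpow (i j : ℤ) : (exponents 2 (genX ^ i * genY ^ j)).toAdd 0 = i ∧
    (exponents 2 (genX ^ i * genY ^ j)).toAdd 1 = j := by
  obtain ⟨h00, h01⟩ := basis_zero_apply
  obtain ⟨h10, h11⟩ := basis_one_apply
  simp [exponents_genX, exponents_genY, h00, h01, h10, h11]

theorem freeAb_two_ext {p q : FreeAb 2} (h0 : p.toAdd 0 = q.toAdd 0)
    (h1 : p.toAdd 1 = q.toAdd 1) : p = q :=
  Multiplicative.toAdd.injective (funext (Fin.forall_fin_two.mpr ⟨h0, h1⟩))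

theorem conj_eq_conj_zpow (g : FreeMetabelian 2) {d : FreeMetabelian 2}
    (hd : exponents 2 d = 1) : g * d * g⁻¹ = genX ^ (exponents 2 g).toAdd 0 *
      (genY ^ (exponents 2 g).toAdd 1 * d * (genY ^ (exponents 2 g).toAdd 1)⁻¹) *
        (genX ^ (exponents 2 g).toAdd 0)⁻¹ := by
  obtain ⟨h0, h1⟩ := exponents_zpow_mul_zpow ((exponents 2 g).toAdd 0) ((exponents 2 g).toAdd 1)
  rw [conj_eq_conj (freeAb_two_ext h0 h1).symm hd, mul_inv_rev]
  simp only [mul_assoc]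

theorem exponents_inv_genC : exponents 2 genC⁻¹ = 1 := by rw [map_inv, exponents_genC, inv_one]

/-- Places of squares are exponents of conjugators, the negatives of coordinates in the base. Thus
nonnegative powers of `genY` describe squares whose leading coordinate is at or below the origin in
its column. -/
theorem squares_subset_upperColumn {d : FreeMetabelian 2}
    (hd : d ∈ squares fun q => q.toAdd 0 = 0 ∧ 0 ≤ q.toAdd 1) : d ∈ coneSet upperColumn := by
  have hy := holds_coneSet (lin upperColumn genY upperColumn genY⁻¹)
  refine squares_subset
    (holds_coneSet (term upperColumn 1))
    (holds_coneSet (bin upperColumn upperColumn upperColumn))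
    (fun g hg => ?_) hd
  obtain ⟨m, hm⟩ := Int.eq_ofNat_of_zero_le hg.2
  rw [conj_eq_conj_zpow g exponents_genC, conj_eq_conj_zpow g exponents_inv_genC, hg.1, hm]
  simp only [zpow_zero, inv_one, one_mul, mul_one, zpow_natCast]
  exact ⟨conj_pow_mem hy m _ (holds_coneSet (term upperColumn genC)),
    conj_pow_mem hy m _ (holds_coneSet (term upperColumn genC⁻¹))⟩

theorem squares_subset_columns {d : FreeMetabelian 2}
    (hd : d ∈ squares fun q => 0 ≤ q.toAdd 0) : d ∈ coneSet columns := by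
  have hx := holds_coneSet (lin columns genX columns genX⁻¹)
  have hy := conj_zpow_mem (holds_coneSet (lin columns genY columns genY⁻¹))
    (holds_coneSet (lin columns genY⁻¹ columns genY))
  refine squares_subset
    (holds_coneSet (term columns 1))
    (holds_coneSet (bin columns columns columns))
    (fun g hg => ?_) hd
  obtain ⟨m, hm⟩ := Int.eq_ofNat_of_zero_le hg
  rw [conj_eq_conj_zpow g exponents_genC, conj_eq_conj_zpow g exponents_inv_genC, hm]
  simp only [zpow_natCast]
  exact ⟨conj_pow_mem hx m _ (hy _ _ (holds_coneSet (term columns genC))),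
    conj_pow_mem hx m _ (hy _ _ (holds_coneSet (term columns genC⁻¹)))⟩

theorem squares_subset_loops {d : FreeMetabelian 2} (hd : d ∈ squares fun _ => True) :
    d ∈ coneSet loops := by
  have h := conj_mem_of_generators
    (holds_coneSet (lin loops genX loops genX⁻¹))
    (holds_coneSet (lin loops genX⁻¹ loops genX))
    (holds_coneSet (lin loops genY loops genY⁻¹))
    (holds_coneSet (lin loops genY⁻¹ loops genY))
  exact squares_subset
    (holds_coneSet (term loops 1))
    (holds_coneSet (bin loops loops loops))
    (fun g _ => ⟨h g _ (holds_coneSet (term loops genC)),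
    h g _ (holds_coneSet (term loops genC⁻¹))⟩) hd

theorem squares_subset_lowerColumn {d : FreeMetabelian 2}
    (hd : d ∈ squares fun q => q.toAdd 0 = 0 ∧ 0 < q.toAdd 1) : d ∈ coneSet lowerColumn := by
  obtain ⟨h0, h1⟩ := basis_one_apply
  have h := (holds_coneSet (lin lowerColumn genY upperColumn genY⁻¹)) _
    (squares_subset_upperColumn (conj_inv_mem_squares genY (fun q hq => by
      simp only [exponents_genY, toAdd_mul, toAdd_inv, Pi.add_apply, Pi.neg_apply, h0, h1]
      omega) hd))
  rwa [show genY * (genY⁻¹ * d * genY) * genY⁻¹ = d by group] at h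

theorem squares_subset_lowerColumns {d : FreeMetabelian 2}
    (hd : d ∈ squares fun q => 0 < q.toAdd 0) : d ∈ coneSet lowerColumns := by
  obtain ⟨h0, -⟩ := basis_zero_apply
  have h := (holds_coneSet (lin lowerColumns genX columns genX⁻¹)) _
    (squares_subset_columns (conj_inv_mem_squares genX (fun q hq => by
      simp only [exponents_genX, toAdd_mul, toAdd_inv, Pi.add_apply, Pi.neg_apply, h0]
      omega) hd))
  rwa [show genX * (genX⁻¹ * d * genX) * genX⁻¹ = d by group] at h

theorem genC_pow_mem_leading (m : ℕ) : genC ^ (m + 1) ∈ coneSet leading := by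
  induction m with
  | zero =>
    rw [zero_add, pow_one]
    exact (holds_coneSet (term leading genC))
  | succ m ih =>
    have h := (holds_coneSet (lin leading genC leading 1)) _ ih
    rwa [mul_one, ← pow_succ'] at h

theorem conj_mem_positiveLoop (t : FreeMetabelian 2) :
    ∀ d ∈ coneSet positiveLoop, t * d * t⁻¹ ∈ coneSet positiveLoop :=
  conj_mem_of_generators
    (holds_coneSet (lin positiveLoop genX positiveLoop genX⁻¹))
    (holds_coneSet (lin positiveLoop genX⁻¹ positiveLoop genX))
    (holds_coneSet (lin positiveLoop genY positiveLoop genY⁻¹))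
    (holds_coneSet (lin positiveLoop genY⁻¹ positiveLoop genY)) t

theorem toLex_lt_two_iff {f g : Fin 2 → ℤ} :
    toLex f < toLex g ↔ f 0 < g 0 ∨ (f 0 = g 0 ∧ f 1 < g 1) := by
  change (∃ i, (∀ j < i, f j = g j) ∧ f i < g i) ↔ _
  simp only [Fin.forall_fin_two, Fin.exists_fin_two, Fin.isValue, not_lt_zero,
    IsEmpty.forall_iff, true_and, lt_self_iff_false, and_true, Fin.zero_lt_one, true_implies]

theorem conj_pow_mul_mem_positiveLoop (t : FreeMetabelian 2) (m : ℕ) {l : FreeMetabelian 2}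
    (hl : l ∈ squares fun q => toLex (exponents 2 t).toAdd < toLex q.toAdd) :
    (t * genC * t⁻¹) ^ (m + 1) * l ∈ coneSet positiveLoop := by
  -- Translating the leading square to the origin leaves squares that are either strictly lower in
  -- the same column or in strictly lower columns; the two rules for these are applied in turn, and
  -- the result is conjugated back.
  have h1 : t⁻¹ * l * t ∈ squares fun q =>
      0 < q.toAdd 0 ∨ (q.toAdd 0 = 0 ∧ 0 < q.toAdd 1) := by
    refine conj_inv_mem_squares t (fun q hq => ?_) hl
    rw [toLex_lt_two_iff] at hq
    simp only [toAdd_mul, toAdd_inv, Pi.add_apply, Pi.neg_apply]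
    omega
  obtain ⟨d₁, hd₁, d₂, hd₂, hd⟩ := exists_mul_of_mem_squares (fun q hq => hq.symm) h1
  have h2 := (holds_coneSet (bin leading leading lowerColumn)) _
    (genC_pow_mem_leading m) _ (squares_subset_lowerColumn hd₁)
  have h3 := (holds_coneSet (bin positiveLoop leading lowerColumns)) _
    h2 _ (squares_subset_lowerColumns hd₂)
  have h4 := conj_mem_positiveLoop t _ h3
  rwa [mul_assoc (genC ^ (m + 1)), ← hd, show t * (genC ^ (m + 1) * (t⁻¹ * l * t)) * t⁻¹ =
    t * genC ^ (m + 1) * t⁻¹ * l by group, ← conj_pow] at h4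

theorem mem_zpowers_of_mem_squares {t d : FreeMetabelian 2}
    (hd : d ∈ squares fun q => q = exponents 2 t) : ∃ z : ℤ, (t * genC * t⁻¹) ^ z = d := by
  have : squares (fun q => q = exponents 2 t) ≤ Subgroup.zpowers (t * genC * t⁻¹) :=
    squares_le fun g hg => by
      rw [conj_eq_conj hg exponents_genC]
      exact Subgroup.mem_zpowers _
  exact this hd

/-- Induction adds a place smaller than all others. By the sign reversal this is the leading
coordinate, so the exponent of its square decides the case, and exponent zero leaves a product over
fewer places. -/
theorem eq_one_or_mem_positiveLoop (s : Finset (Lex (Fin 2 → ℤ))) :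
    ∀ d ∈ squares (fun q => toLex q.toAdd ∈ s),
      d = 1 ∨ d ∈ coneSet positiveLoop ∨ d⁻¹ ∈ coneSet positiveLoop := by
  induction s using Finset.induction_on_min with
  | empty =>
    intro d hd
    left
    have : squares (fun q => toLex q.toAdd ∈ (∅ : Finset (Lex (Fin 2 → ℤ)))) ≤ ⊥ :=
      squares_le fun g hg => absurd hg (Finset.notMem_empty _)
    exact this hd
  | insert a s ha ih =>
    intro d hd
    obtain ⟨h0, h1⟩ := exponents_zpow_mul_zpow (ofLex a 0) (ofLex a 1)
    generalize genX ^ (ofLex a 0) * genY ^ (ofLex a 1) = t at h0 h1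
    have hta : toLex (exponents 2 t).toAdd = a := by
      apply ofLex.injective
      exact funext (Fin.forall_fin_two.mpr ⟨h0, h1⟩)
    obtain ⟨d₁, hd₁, d₂, hd₂, rfl⟩ := exists_mul_of_mem_squares
      (U₁ := fun q => q = exponents 2 t) (U₂ := fun q => toLex q.toAdd ∈ s)
      (fun q hq => (Finset.mem_insert.mp hq).imp_left fun h => by
        rw [← hta] at h
        exact Multiplicative.toAdd.injective (toLex.injective h)) hd
    have hl : squares (fun q => toLex q.toAdd ∈ s) ≤
        squares fun q => toLex (exponents 2 t).toAdd < toLex q.toAdd :=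
      squares_mono fun q hq => hta.symm ▸ ha _ hq
    have hcomm := mul_comm_of_exponents (exponents_of_mem_squares hd₁)
      (exponents_of_mem_squares hd₂)
    obtain ⟨z, rfl⟩ := mem_zpowers_of_mem_squares hd₁
    rcases lt_trichotomy z 0 with hz | rfl | hz
    · right; right
      obtain ⟨m, rfl⟩ : ∃ m : ℕ, z = -((m + 1 : ℕ) : ℤ) := ⟨(-z).toNat - 1, by omega⟩
      rw [hcomm, mul_inv_rev, zpow_neg, inv_inv, zpow_natCast]
      exact conj_pow_mul_mem_positiveLoop t m (hl (inv_mem hd₂))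
    · simpa using ih d₂ hd₂
    · right; left
      obtain ⟨m, rfl⟩ : ∃ m : ℕ, z = (m + 1 : ℕ) := ⟨z.toNat - 1, by omega⟩
      rw [zpow_natCast]
      exact conj_pow_mul_mem_positiveLoop t m (hl hd₂)

theorem exists_finset_of_mem_squares {d : FreeMetabelian 2} (hd : d ∈ squares fun _ => True) :
    ∃ s : Finset (Lex (Fin 2 → ℤ)), d ∈ squares fun q => toLex q.toAdd ∈ s := by
  classical
  induction hd using Subgroup.closure_induction with
  | mem d hd =>
    obtain ⟨g, -, rfl⟩ := hd
    exact ⟨{toLex (exponents 2 g).toAdd}, conj_genC_mem_squares (Finset.mem_singleton_self _)⟩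
  | one => exact ⟨∅, one_mem _⟩
  | mul _ _ _ _ hd he =>
    obtain ⟨s, hs⟩ := hd
    obtain ⟨s', hs'⟩ := he
    exact ⟨s ∪ s', mul_mem (squares_mono (fun _ h => Finset.mem_union_left _ h) hs)
      (squares_mono (fun _ h => Finset.mem_union_right _ h) hs')⟩
  | inv _ _ hd =>
    obtain ⟨s, hs⟩ := hd
    exact ⟨s, inv_mem hs⟩

/-- Modulo the squares the generators commute, so the quotient map depends only on the two
exponents. -/
theorem mem_squares_of_exponents {g : FreeMetabelian 2} (hg : exponents 2 g = 1) :
    g ∈ squares fun _ => True := by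
  have : (squares fun _ => True).Normal :=
    ⟨fun d hd t => conj_mem_squares t (fun _ _ => trivial) hd⟩
  let π := QuotientGroup.mk' (squares fun _ => True)
  have hc : Commute (π genX) (π genY) := by
    have h : π genC = 1 := (QuotientGroup.eq_one_iff _).mpr (by
      have := conj_genC_mem_squares (U := fun _ => True) (g := 1) trivial
      simpa using this)
    rw [genC, map_mul, map_mul, map_mul, map_inv, map_inv, mul_inv_eq_one,
      mul_inv_eq_iff_eq_mul] at h
    exact h
  -- The candidate for the quotient map, written in terms of exponents; commutation of the images of
  -- the generators makes it multiplicative.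
  let ψ : FreeMetabelian 2 →* FreeMetabelian 2 ⧸ (squares fun _ => True) :=
    MonoidHom.mk' (fun g => π genX ^ (exponents 2 g).toAdd 0 * π genY ^ (exponents 2 g).toAdd 1)
      fun g h => by
        have := (hc.zpow_zpow ((exponents 2 h).toAdd 0) ((exponents 2 g).toAdd 1)).eq
        simp only [map_mul, toAdd_mul, Pi.add_apply, zpow_add, mul_assoc]
        rw [← mul_assoc (π genY ^ _) (π genX ^ _), ← this]
        simp only [mul_assoc]
  have hψ : ψ = π := by
    obtain ⟨h00, h01⟩ := basis_zero_apply
    obtain ⟨h10, h11⟩ := basis_one_apply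
    refine QuotientGroup.monoidHom_ext _ (FreeGroup.ext_hom _ _ (Fin.forall_fin_two.mpr ⟨?_, ?_⟩))
    · change π genX ^ (exponents 2 genX).toAdd 0 * π genY ^ (exponents 2 genX).toAdd 1 = π genX
      rw [exponents_genX, h00, h01, zpow_one, zpow_zero, mul_one]
    · change π genX ^ (exponents 2 genY).toAdd 0 * π genY ^ (exponents 2 genY).toAdd 1 = π genY
      rw [exponents_genY, h10, h11, zpow_one, zpow_zero, one_mul]
  have h1 : π g = 1 := by
    rw [← hψ]
    change π genX ^ (exponents 2 g).toAdd 0 * π genY ^ (exponents 2 g).toAdd 1 = 1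
    rw [hg]
    simp
  exact (QuotientGroup.eq_one_iff _).mp h1

theorem zpow_mem_powerY (z : ℤ) : genY ^ z ∈ coneSet powerY := by
  induction z with
  | zero =>
    exact (holds_coneSet (term powerY 1))
  | succ m ih =>
    have h := (holds_coneSet (lin powerY genY powerY 1)) _ ih
    rwa [mul_one, ← zpow_one_add, add_comm] at h
  | pred m ih =>
    have h := (holds_coneSet (lin powerY genY⁻¹ powerY 1)) _ ih
    rwa [mul_one, ← zpow_neg_one, ← zpow_add, add_comm, ← sub_eq_add_neg] at h

theorem pow_mem_positivePowerY (m : ℕ) : genY ^ (m + 1) ∈ coneSet positivePowerY := by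
  induction m with
  | zero =>
    rw [zero_add, pow_one]
    exact (holds_coneSet (term positivePowerY genY))
  | succ m ih =>
    have h := (holds_coneSet (lin positivePowerY genY positivePowerY 1)) _ ih
    rwa [mul_one, ← pow_succ'] at h

theorem pow_mem_positivePowerX (m : ℕ) : genX ^ (m + 1) ∈ coneSet positivePowerX := by
  induction m with
  | zero =>
    rw [zero_add, pow_one]
    exact (holds_coneSet (term positivePowerX genX))
  | succ m ih =>
    have h := (holds_coneSet (lin positivePowerX genX positivePowerX 1)) _ ih
    rwa [mul_one, ← pow_succ'] at h

theorem coneSet_start : coneSet start = positiveCone magnusOrder := by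
  refine Set.Subset.antisymm (leastSolution_subset holds_coneSolution start) fun g hg => ?_
  rcases mem_positiveCone_magnusOrder.mp hg with h | ⟨p, h⟩
  -- With a positive image in `ℤ²`, `g` is an arbitrary loop times any chosen representative of that
  -- image.
  · have hloop : ∀ t, exponents 2 t = exponents 2 g → g * t⁻¹ ∈ coneSet loops := fun t ht =>
      squares_subset_loops (mem_squares_of_exponents (by
        rw [map_mul, map_inv, ht, mul_inv_cancel]))
    rcases mem_positiveCone_two_iff.mp h with h | ⟨h0, h⟩
    · obtain ⟨m, hm⟩ : ∃ m : ℕ, (exponents 2 g).toAdd 0 = (m + 1 : ℕ) :=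
        ⟨((exponents 2 g).toAdd 0).toNat - 1, by omega⟩
      have ht : genY ^ (exponents 2 g).toAdd 1 * genX ^ (m + 1) ∈ coneSet positiveX :=
        (holds_coneSet (bin positiveX powerY positivePowerX)) _
          (zpow_mem_powerY _) _ (pow_mem_positivePowerX m)
      have hexp : exponents 2 (genY ^ (exponents 2 g).toAdd 1 * genX ^ (m + 1)) =
          exponents 2 g := by
        obtain ⟨h0, h1⟩ := exponents_zpow_mul_zpow (m + 1 : ℕ) ((exponents 2 g).toAdd 1)
        rw [zpow_natCast, map_mul, mul_comm, ← map_mul] at h0 h1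
        exact freeAb_two_ext (h0.trans hm.symm) h1
      have := (holds_coneSet (bin start loops positiveX)) _
        (hloop _ hexp) _ ht
      rwa [inv_mul_cancel_right] at this
    · obtain ⟨m, hm⟩ : ∃ m : ℕ, (exponents 2 g).toAdd 1 = (m + 1 : ℕ) :=
        ⟨((exponents 2 g).toAdd 1).toNat - 1, by omega⟩
      have hexp : exponents 2 (genY ^ (m + 1)) = exponents 2 g := by
        obtain ⟨h0', h1⟩ := exponents_zpow_mul_zpow 0 (m + 1 : ℕ)
        rw [zpow_natCast, zpow_zero, one_mul] at h0' h1
        exact freeAb_two_ext (h0'.trans h0.symm) (h1.trans hm.symm)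
      have := (holds_coneSet (bin start loops positivePowerY)) _
        (hloop _ hexp) _ (pow_mem_positivePowerY m)
      rwa [inv_mul_cancel_right] at this
  · obtain ⟨s, hs⟩ := exists_finset_of_mem_squares (mem_squares_of_exponents h.1.1)
    rcases eq_one_or_mem_positiveLoop s g hs with rfl | h' | h'
    · exact absurd hg one_notMem_positiveCone
    · have := (holds_coneSet (lin start 1 positiveLoop 1)) _ h'
      rwa [one_mul, mul_one] at this
    -- If the grammar produced the inverse, soundness would make both `g` and `g⁻¹` positive.
    · have h1 : g⁻¹ ∈ positiveCone (magnusOrder (n := 2)) :=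
        mem_positiveCone_magnusOrder.mpr
          (Or.inr (leastSolution_subset holds_coneSolution positiveLoop h'))
      have h2 := magnusOrder_isBiOrder.mul_mem hg h1
      rw [mul_inv_cancel] at h2
      exact absurd h2 one_notMem_positiveCone

theorem magnusOrder_isContextFreeOrder : IsContextFreeOrder (magnusOrder (n := 2)) :=
  ⟨FreeMetabelian.fg 2, fun _ _ hs => by
    obtain ⟨L, hL, h⟩ := exists_isContextFree_leastSolution hs positiveConeRules start
    exact ⟨L, hL, h.trans coneSet_start⟩⟩

end ConeComplete

end BiOrd

theorem mainTheorem6 :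
    (∀ n : ℕ, BiOrd.ComputablyBiOrderable (BiOrd.FreeMetabelian n)) ∧
    (∀ n : ℕ, ∃ φ : BiOrd.FreeMetabelian n →* BiOrd.Wreath (BiOrd.FreeAb n) (BiOrd.FreeAb n),
      BiOrd.IsMagnus φ ∧ Function.Injective φ ∧
      ∃ rA rT : BiOrd.FreeAb n → BiOrd.FreeAb n → Prop,
        BiOrd.IsBiOrder rA ∧ BiOrd.IsBiOrder rT ∧
        BiOrd.IsRegularFor BiOrd.FreeAb.basis rA ∧ BiOrd.IsRegularFor BiOrd.FreeAb.basis rT ∧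
        BiOrd.IsBiOrder (BiOrd.lexOrder rA rT) ∧
        BiOrd.IsBiOrder (fun u v => BiOrd.lexOrder rA rT (φ u) (φ v)) ∧
        BiOrd.IsComputableOrder (fun u v => BiOrd.lexOrder rA rT (φ u) (φ v))) ∧
    Nonempty (BiOrd.FreeMetabelian 1 ≃* Multiplicative ℤ) ∧
    (∃ r : BiOrd.FreeMetabelian 1 → BiOrd.FreeMetabelian 1 → Prop,
      BiOrd.IsBiOrder r ∧ BiOrd.IsRegularOrder r) ∧
    (∃ r : BiOrd.FreeMetabelian 2 → BiOrd.FreeMetabelian 2 → Prop,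
      BiOrd.IsBiOrder r ∧ BiOrd.IsContextFreeOrder r) := by
  have hcomp (n : ℕ) : BiOrd.IsComputableOrder (BiOrd.magnusOrder (n := n)) :=
    BiOrd.magnusOrder_isComputableOrder
  refine ⟨fun n => ⟨_, BiOrd.magnusOrder_isBiOrder, hcomp n⟩, fun n => ⟨BiOrd.magnus n,
    BiOrd.magnus_isMagnus, BiOrd.magnus_injective, BiOrd.lexLE, BiOrd.lexLE,
    BiOrd.lexLE_isBiOrder, BiOrd.lexLE_isBiOrder, BiOrd.lexLE_isRegularFor,
    BiOrd.lexLE_isRegularFor, BiOrd.lexOrder_isBiOrder BiOrd.lexLE_isBiOrder BiOrd.lexLE_isBiOrder,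
    BiOrd.magnusOrder_isBiOrder, hcomp n⟩, ⟨MulEquiv.ofBijective _ BiOrd.rankOneHom_bijective⟩,
    ⟨_, BiOrd.rankOneOrder_isBiOrder, BiOrd.rankOneOrder_isRegularOrder⟩,
    ⟨_, BiOrd.magnusOrder_isBiOrder, BiOrd.magnusOrder_isContextFreeOrder⟩⟩
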